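/- Let $L>0$. There is a constant $C_R>0$, depending only on $L$, such that the following holds. Let $1<\alpha,\beta<2$, $K_\alpha,K_\beta>0$, $T>0$, $\Omega=(x_L,x_R)\times(y_D,y_U)$ with $x_L<x_R$, $y_D<y_U$, and consider $$\frac{\partial u}{\partial t}=K_\alpha\frac{\partial^\alpha u}{\partial|x|^\alpha}+K_\beta\frac{\partial^\beta u}{\partial|y|^\beta}+f(x,y,t,u)\ \text{ on }\Omega\times(0,T],\qquad u(\cdot,\cdot,0)=u_0\text{ on }\Omega,\qquad u=0\text{ on }(\mathbb R^2\setminus\Omega)\times(0,T],$$ where $\frac{\partial^\alpha u}{\partial|x|^\alpha}=-\frac{1}{2\cos(\alpha\pi/2)}\big({}_{x_L}D_x^\alpha u+{}_xD_{x_R}^\alpha u\big)$ with the left and right Riemann–Liouville derivatives on $(x_L,x_R)$, and likewise in $y$ on $(y_D,y_U)$. Let $f$ be continuous on $\Omega\times(0,T]\times\mathbb R$ with $|f(x,y,t,v)-f(x,y,t,w)|\le L|v-w|$, and let it be $C^2$ in its last argument $v$, with $\partial_v^2 f$ bounded on $\Omega\times(0,T]\times[-R,R]$ for every $R>0$. Let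 $u$ be an exact solution which is smooth in the following sense, with bounds uniform on $\Omega\times[0,T]$: * for $y\in(y_D,y_U)$ and $t\in[0,T]$ the extension by zero to $\mathbb R$ of $u(\cdot,y,t)|_{(x_L,x_R)}$ is a continuous function $v$ in $L^1(\mathbb R)$ with $\int_{\mathbb R}(1+|\eta|)^{4+\alpha}|\hat v(\eta)|\,d\eta$ bounded; for $x\in(x_L,x_R)$ and $t\in[0,T]$ the same holds for $u(x,\cdot,t)|_{(y_D,y_U)}$ with $\beta$ in place of $\alpha$; * for each $(x,y)\in\Omega$, $t\mapsto u(x,y,t)$ is $C^3$ on $[0,T]$ with bounded first, second and third derivatives, and $t\mapsto\big(K_\alpha\frac{\partial^\alpha u}{\partial|x|^\alpha}+K_\beta\frac{\partial^\beta u}{\partial|y|^\beta}\big)(x,y,t)$ is $C^2$ on $[0,T]$ with bounded second derivative. For positive integers $M,N_x,N_y$ put $\Delta t=T/M$, $h_x=\frac{x_R-x_L}{N_x+1}$, $h_y=\frac{y_U-y_D}{N_y+1}$, $t_m=m\Delta t$, $t_{m+1/2}=(m+\tfrac12)\Delta t$, $x_i=x_L+ih_x$, $y_j=y_D+jh_y$,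 $\eta_\alpha=\frac{K_\alpha\Delta t}{2h_x^\alpha}$, $\eta_\beta=\frac{K_\beta\Delta t}{2h_y^\beta}$, and let $s_k^{(\gamma)}$ be the Fourier coefficients in $S(\omega)=\big[1+\tfrac{\gamma}{24}(2-\omega-\omega^{-1})\big](2-\omega-\omega^{-1})^{\gamma/2}=\sum_{k\in\mathbb Z}s_k^{(\gamma)}\omega^k$, $\omega=e^{\mathbf i\theta}$. Let $A_\alpha=(s^{(\alpha)}_{i-j})_{i,j=1}^{N_x}$, $A_\beta=(s^{(\beta)}_{i-j})_{i,j=1}^{N_y}$ and $J=\eta_\alpha(I_{N_y}\otimes A_\alpha)+\eta_\beta(A_\beta\otimes I_{N_x})$. Let $U^0,\dots,U^M\in\mathbb R^{N_xN_y}$ solve the scheme $$(I+J)U^{m+1}=(I-J)U^m+\Delta t\Big(\tfrac32 f(x_i,y_j,t_{m+1/2},U^m_{i,j})-\tfrac12 f(x_i,y_j,t_{m+1/2},U^{m-1}_{i,j})\Big)_{i,j},\qquad 0\le m\le M-1,$$ with $U^0_{i,j}=u_0(x_i,y_j)$ and $U^{-1}=U^0$. Then there is a constant $C^*>0$, independent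 of $M,N_x,N_y$, such that for all positive integers $M,N_x,N_y$ and all $m=0,1,\dots,M-1$ $$\|u^{m+1}-U^{m+1}\|\le T\,C^*\exp(3T\,C_R)\,(\Delta t^2+h_x^4+h_y^4),$$ where $u^m=(u(x_i,y_j,t_m))_{i,j}$ and $\|V\|=\big(h_xh_y\sum_{i=1}^{N_x}\sum_{j=1}^{N_y}V_{i,j}^2\big)^{1/2}$. Thus the scheme is of second order in time and of fourth order in space. -/

import Mathlib

open scoped FourierTransform Matrix Kronecker

namespace RieszRD

noncomputable section

/-! Riesz fractional derivatives of order in (1, 2) on an interval -/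

/-- Left Riemann-Liouville derivative of order `α ∈ (1,2)` with base point `a`:
`1/Γ(2-α) · d²/dx² ∫_a^x v(ξ) (x-ξ)^(1-α) dξ`. -/
def leftRL (α a : ℝ) (v : ℝ → ℝ) (x : ℝ) : ℝ :=
  (Real.Gamma (2 - α))⁻¹ *
    iteratedDeriv 2 (fun z => ∫ ξ in a..z, v ξ * (z - ξ) ^ (1 - α)) x

/-- Right Riemann-Liouville derivative of order `α ∈ (1,2)` with base point `b`:
`1/Γ(2-α) · d²/dx² ∫_x^b v(ξ) (ξ-x)^(1-α) dξ`. -/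
def rightRL (α b : ℝ) (v : ℝ → ℝ) (x : ℝ) : ℝ :=
  (Real.Gamma (2 - α))⁻¹ *
    iteratedDeriv 2 (fun z => ∫ ξ in z..b, v ξ * (ξ - z) ^ (1 - α)) x

/-- Riesz derivative on `(a,b)`: `σ_α` times the sum of the two Riemann-Liouville derivatives,
`σ_α = -1/(2 cos(απ/2))`. -/
def riesz (α a b : ℝ) (v : ℝ → ℝ) (x : ℝ) : ℝ :=
  -1 / (2 * Real.cos (α * Real.pi / 2)) * (leftRL α a v x + rightRL α b v x)

/-- The weighted Fourier integral `∫ (1+|η|)^r |v̂(η)| dη ∈ [0,∞]`. Mathlib's Fourier transform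
carries the frequency `2πη`; rescaling `η` changes the value by bounded factors only. -/
def fourierWeight (r : ℝ) (v : ℝ → ℝ) : ENNReal :=
  ∫⁻ η : ℝ, ENNReal.ofReal ((1 + |η|) ^ r) * ‖𝓕 (fun x : ℝ => (v x : ℂ)) η‖ₑ

/-- `v` lies in the ball of size `B` of the space `𝓛^r(ℝ)` of all `v ∈ L¹(ℝ)` with
`∫ (1+|η|)^r |v̂(η)| dη < ∞`. For `r ≥ 0` such a `v` has a continuous representative, and `v` is
required to be that one, so that its point values are meaningful. -/
def InFourierBall (r : ℝ) (B : NNReal) (v : ℝ → ℝ) : Prop :=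
  Continuous v ∧ MeasureTheory.Integrable v ∧ fourierWeight r v ≤ (B : ENNReal)

/-! The initial-boundary value problem -/

/-- The data of the two-dimensional Riesz space-fractional reaction-diffusion equation
`∂u/∂t = K_α ∂^α u/∂|x|^α + K_β ∂^β u/∂|y|^β + f(x,y,t,u)` on `(xL,xR) × (yD,yU) × (0,T]`
with initial value `u₀` and zero exterior values. -/
structure Problem where
  α : ℝ
  β : ℝ
  Kα : ℝ
  Kβ : ℝ
  xL : ℝ
  xR : ℝ
  yD : ℝ
  yU : ℝ
  T : ℝ
  f : ℝ → ℝ → ℝ → ℝ → ℝ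
  u₀ : ℝ → ℝ → ℝ
  hα : α ∈ Set.Ioo (1 : ℝ) 2
  hβ : β ∈ Set.Ioo (1 : ℝ) 2
  hKα : 0 < Kα
  hKβ : 0 < Kβ
  hx : xL < xR
  hy : yD < yU
  hT : 0 < T

namespace Problem

variable (P : Problem)

/-- The spatial domain `Ω`. -/
def Ω : Set (ℝ × ℝ) := Set.Ioo P.xL P.xR ×ˢ Set.Ioo P.yD P.yU

/-- The diffusion term `K_α ∂^α u/∂|x|^α + K_β ∂^β u/∂|y|^β` at `(x,y,t)`. -/
def diffusion (u : ℝ → ℝ → ℝ → ℝ) (x y t : ℝ) : ℝ :=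
  P.Kα * riesz P.α P.xL P.xR (fun ξ => u ξ y t) x +
    P.Kβ * riesz P.β P.yD P.yU (fun ζ => u x ζ t) y

/-- `f` is continuous, and Lipschitz in its last argument with constant `L`. -/
def LipschitzSource (L : ℝ) : Prop :=
  ContinuousOn (fun p : (ℝ × ℝ) × ℝ × ℝ => P.f p.1.1 p.1.2 p.2.1 p.2.2)
      (P.Ω ×ˢ Set.Ioc 0 P.T ×ˢ Set.univ) ∧
    ∀ x y, (x, y) ∈ P.Ω → ∀ t ∈ Set.Ioc 0 P.T, ∀ v w : ℝ,
      |P.f x y t v - P.f x y t w| ≤ L * |v - w|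

/-- `f` is twice continuously differentiable in its last argument, and this second derivative is
bounded uniformly in `(x,y,t)` and locally uniformly in the last argument. -/
def SmoothSource : Prop :=
  (∀ x y, (x, y) ∈ P.Ω → ∀ t ∈ Set.Ioc 0 P.T, ContDiff ℝ 2 (P.f x y t)) ∧
    ∀ R : ℝ, ∃ B : ℝ, ∀ x y, (x, y) ∈ P.Ω → ∀ t ∈ Set.Ioc 0 P.T, ∀ v : ℝ, |v| ≤ R →
      |iteratedDeriv 2 (P.f x y t) v| ≤ B

/-- `u` solves the initial-boundary value problem. The time derivative is one-sided at `t = T`. -/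
structure IsExactSolution (u : ℝ → ℝ → ℝ → ℝ) : Prop where
  equation : ∀ x y, (x, y) ∈ P.Ω → ∀ t ∈ Set.Ioc 0 P.T,
    HasDerivWithinAt (fun s => u x y s) (P.diffusion u x y t + P.f x y t (u x y t))
      (Set.Icc 0 P.T) t
  initial : ∀ x y, (x, y) ∈ P.Ω → u x y 0 = P.u₀ x y
  exterior : ∀ x y, (x, y) ∉ P.Ω → ∀ t ∈ Set.Ioc 0 P.T, u x y t = 0

/-- Smoothness of `u`, with a bound `B` that is uniform on `Ω × [0,T]`: the zero extensions of the
spatial slices lie in `𝓛^{4+α}(ℝ)` and `𝓛^{4+β}(ℝ)`, `u` has three bounded continuous derivatives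
in `t`, and the diffusion term has a bounded continuous second derivative in `t`. In particular the
Riemann-Liouville derivatives of the slices exist in the classical sense. -/
structure IsSmooth (u : ℝ → ℝ → ℝ → ℝ) (B : NNReal) : Prop where
  space_x : ∀ y ∈ Set.Ioo P.yD P.yU, ∀ t ∈ Set.Icc 0 P.T,
    InFourierBall (4 + P.α) B ((Set.Ioo P.xL P.xR).indicator fun x => u x y t)
  space_y : ∀ x ∈ Set.Ioo P.xL P.xR, ∀ t ∈ Set.Icc 0 P.T,
    InFourierBall (4 + P.β) B ((Set.Ioo P.yD P.yU).indicator fun y => u x y t)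
  time : ∀ x y, (x, y) ∈ P.Ω → ContDiffOn ℝ 3 (fun t => u x y t) (Set.Icc 0 P.T)
  time_bound : ∀ x y, (x, y) ∈ P.Ω → ∀ k ∈ Finset.Icc 1 3, ∀ t ∈ Set.Icc 0 P.T,
    |iteratedDerivWithin k (fun s => u x y s) (Set.Icc 0 P.T) t| ≤ B
  diffusion_time : ∀ x y, (x, y) ∈ P.Ω →
    ContDiffOn ℝ 2 (fun t => P.diffusion u x y t) (Set.Icc 0 P.T)
  diffusion_bound : ∀ x y, (x, y) ∈ P.Ω → ∀ t ∈ Set.Icc 0 P.T,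
    |iteratedDerivWithin 2 (fun s => P.diffusion u x y s) (Set.Icc 0 P.T) t| ≤ B

end Problem

/-! The difference scheme -/

/-- The `k`-th Fourier coefficient `s_k^{(α)}` of the generating function
`S(ω) = [1 + (α/24)(2 - ω - ω⁻¹)] (2 - ω - ω⁻¹)^{α/2}`, `ω = e^{iθ}`. Here `2 - ω - ω⁻¹` is the
real even function `2 - 2 cos θ`, so that the coefficient is real and `e^{-ikθ}` may be replaced by
`cos (kθ)`. -/
def coeff (α : ℝ) (k : ℤ) : ℝ :=
  (2 * Real.pi)⁻¹ * ∫ θ in (-Real.pi)..Real.pi,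
    (1 + α / 24 * (2 - 2 * Real.cos θ)) * (2 - 2 * Real.cos θ) ^ (α / 2) * Real.cos (k * θ)

/-- The symmetric Toeplitz matrix `A_α` of order `n`, with entries `s_{i-j}^{(α)}`. -/
def toeplitz (α : ℝ) (n : ℕ) : Matrix (Fin n) (Fin n) ℝ :=
  Matrix.of fun i j => coeff α ((i : ℤ) - (j : ℤ))

namespace Problem

variable (P : Problem)

/-- The time step. -/
def dt (M : ℕ) : ℝ := P.T / M

/-- The mesh width in `x`. -/
def hX (Nx : ℕ) : ℝ := (P.xR - P.xL) / (Nx + 1)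

/-- The mesh width in `y`. -/
def hY (Ny : ℕ) : ℝ := (P.yU - P.yD) / (Ny + 1)

/-- The interior grid points in `x`; the index `i = 0, …, Nx - 1` stands for `i + 1` in
`x_1, …, x_Nx`. -/
def gridX (Nx : ℕ) (i : Fin Nx) : ℝ := P.xL + ((i : ℝ) + 1) * P.hX Nx

/-- The interior grid points in `y`, indexed likewise. -/
def gridY (Ny : ℕ) (j : Fin Ny) : ℝ := P.yD + ((j : ℝ) + 1) * P.hY Ny

/-- The matrix `J = η_α (I ⊗ A_α) + η_β (A_β ⊗ I)`, with `η_α = K_α Δt / (2 h_x^α)` and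
`η_β = K_β Δt / (2 h_y^β)`. Grid vectors are indexed by pairs `(j, i)`, with `j` the index in `y`
and `i` the index in `x`. -/
def J (M Nx Ny : ℕ) : Matrix (Fin Ny × Fin Nx) (Fin Ny × Fin Nx) ℝ :=
  (P.Kα * P.dt M / (2 * P.hX Nx ^ P.α)) •
      ((1 : Matrix (Fin Ny) (Fin Ny) ℝ) ⊗ₖ toeplitz P.α Nx) +
    (P.Kβ * P.dt M / (2 * P.hY Ny ^ P.β)) •
      (toeplitz P.β Ny ⊗ₖ (1 : Matrix (Fin Nx) (Fin Nx) ℝ))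

/-- The grid vector with entries `f(x_i, y_j, t_{m+1/2}, V_{i,j})`. -/
def source (M Nx Ny m : ℕ) (V : Fin Ny × Fin Nx → ℝ) : Fin Ny × Fin Nx → ℝ :=
  fun p => P.f (P.gridX Nx p.2) (P.gridY Ny p.1) (((m : ℝ) + 1 / 2) * P.dt M) (V p)

/-- `U^0, …, U^M` is a solution of the linearized Crank-Nicolson scheme
`(I+J) U^{m+1} = (I-J) U^m + Δt (3/2 f(t_{m+1/2}, U^m) - 1/2 f(t_{m+1/2}, U^{m-1}))`
for `0 ≤ m ≤ M-1`, started with `U_{i,j}^0 = u₀(x_i,y_j)` and `U^{-1} = U^0`. The latter convention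
is the truncated subtraction `0 - 1 = 0` in the index `m - 1`. -/
structure IsSchemeSolution (M Nx Ny : ℕ) (U : ℕ → Fin Ny × Fin Nx → ℝ) : Prop where
  initial : ∀ p, U 0 p = P.u₀ (P.gridX Nx p.2) (P.gridY Ny p.1)
  step : ∀ m < M,
    (1 + P.J M Nx Ny) *ᵥ U (m + 1) = (1 - P.J M Nx Ny) *ᵥ U m +
      P.dt M • ((3 / 2 : ℝ) • P.source M Nx Ny m (U m) -
        (1 / 2 : ℝ) • P.source M Nx Ny m (U (m - 1)))

/-- The grid vector of the values `u(x_i, y_j, t_m)`, `t_m = m Δt`. -/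
def sample (M Nx Ny : ℕ) (u : ℝ → ℝ → ℝ → ℝ) (m : ℕ) : Fin Ny × Fin Nx → ℝ :=
  fun p => u (P.gridX Nx p.2) (P.gridY Ny p.1) ((m : ℝ) * P.dt M)

/-- The discrete `L²` norm `(h_x h_y ∑_{i,j} V_{i,j}²)^{1/2}`. -/
def discNorm (Nx Ny : ℕ) (V : Fin Ny × Fin Nx → ℝ) : ℝ :=
  Real.sqrt (P.hX Nx * P.hY Ny * ∑ i : Fin Nx, ∑ j : Fin Ny, V (j, i) ^ 2)

end Problem

end

end RieszRD

/-! Stability. The generating function `symbol` is nonnegative, so the Toeplitz matrices and `J` are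
positive semidefinite. Testing `(I + J)V = (I - J)W + G` against `V + W` gives `‖V‖ ≤ ‖W‖ + ‖G‖`
with no restriction on the mesh (`discNorm_step`). Together with the Lipschitz bound on `f` this
yields a two-step recursion for the error (`IsSchemeSolution.error_step`), which `discrete_gronwall`
sums. What remains is the residual of the exact solution (`IsSmooth.abs_residual_le`).

Space. Both operators are Fourier multipliers on the zero extension of a slice: the scaled Toeplitz
matrix has multiplier `S(hξ)/h^α` (`toeplitz_mulVec_eq`), the Riesz derivative `-|ξ|^α`
(`riesz_eq_integral`, via the Laplace transform of the Riemann-Liouville kernel). The factor `1 +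
(α/24)(2 - ω - ω⁻¹)` cancels the leading error of `(2 - ω - ω⁻¹)^(α/2)`, so the symbols differ by at
most `h⁴|ξ|^(4+α)` (`abs_scaled_symbol_sub_le`). The weighted Fourier bound on `u` turns this into a
pointwise error of order `h⁴` (`toeplitz_add_riesz_le`).

Time. Taylor expansion at the midpoint of a step gives a residual of order `Δt³`, except on the
first step: there `U^{-1} = U^0`, nothing is extrapolated, and the residual is only of order `Δt²`.
As this happens once, it enters the Gronwall sum as a single perturbation and is not multiplied by
the number of steps. -/

namespace RieszRD

open MeasureTheory

/-! ### Positivity of the Toeplitz matrices -/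

/-- The generating function of the difference scheme, as a function of the angle. -/
noncomputable def symbol (α θ : ℝ) : ℝ :=
  (1 + α / 24 * (2 - 2 * Real.cos θ)) * (2 - 2 * Real.cos θ) ^ (α / 2)

theorem two_sub_two_cos_nonneg (θ : ℝ) : 0 ≤ 2 - 2 * Real.cos θ := by
  linarith [Real.cos_le_one θ]

theorem symbol_nonneg {α : ℝ} (hα : 0 ≤ α) (θ : ℝ) : 0 ≤ symbol α θ := by
  have := two_sub_two_cos_nonneg θ
  unfold symbol
  positivity

theorem continuous_symbol {α : ℝ} (hα : 0 ≤ α) : Continuous (symbol α) := by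
  unfold symbol
  refine Continuous.mul (by fun_prop) (Continuous.rpow_const (by fun_prop) fun _ => Or.inr ?_)
  positivity

theorem coeff_eq (α : ℝ) (k : ℤ) : coeff α k =
    (2 * Real.pi)⁻¹ * ∫ θ in (-Real.pi)..Real.pi, symbol α θ * Real.cos (k * θ) := rfl

theorem coeff_neg (α : ℝ) (k : ℤ) : coeff α (-k) = coeff α k := by
  simp [coeff_eq]

/-- The quadratic form equals `(2π)⁻¹ ∫ S(θ) |∑ x_k e^{ikθ}|² dθ`, whose integrand is nonnegative.
-/
theorem toeplitz_quadratic_nonneg {α : ℝ} (hα : 0 ≤ α) {n : ℕ} (x : Fin n → ℝ) :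
    0 ≤ x ⬝ᵥ (toeplitz α n *ᵥ x) := by
  have hc := continuous_symbol hα
  have key : x ⬝ᵥ (toeplitz α n *ᵥ x) = (2 * Real.pi)⁻¹ * ∫ θ in (-Real.pi)..Real.pi,
      symbol α θ * ((∑ i, x i * Real.cos (i * θ)) ^ 2 + (∑ i, x i * Real.sin (i * θ)) ^ 2) := by
    have h1 : ∀ θ : ℝ, symbol α θ *
        ((∑ i, x i * Real.cos (i * θ)) ^ 2 + (∑ i, x i * Real.sin (i * θ)) ^ 2) =
        ∑ i, ∑ j, x i * x j * (symbol α θ * Real.cos (((i : ℤ) - (j : ℤ) : ℤ) * θ)) := by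
      intro θ
      rw [sq, sq, Finset.sum_mul_sum, Finset.sum_mul_sum, ← Finset.sum_add_distrib,
        Finset.mul_sum]
      refine Finset.sum_congr rfl fun i _ => ?_
      rw [← Finset.sum_add_distrib, Finset.mul_sum]
      refine Finset.sum_congr rfl fun j _ => ?_
      push_cast
      rw [sub_mul, Real.cos_sub]
      ring
    simp_rw [h1]
    have hi : ∀ i j : Fin n, IntervalIntegrable (fun θ => x i * x j *
        (symbol α θ * Real.cos (((i : ℤ) - (j : ℤ) : ℤ) * θ))) volume (-Real.pi) Real.pi :=
      fun i j => Continuous.intervalIntegrable (by fun_prop) _ _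
    rw [intervalIntegral.integral_finsetSum]
    · rw [dotProduct, Finset.mul_sum]
      refine Finset.sum_congr rfl fun i _ => ?_
      rw [intervalIntegral.integral_finsetSum (fun j _ => hi i j), Matrix.mulVec, dotProduct,
        Finset.mul_sum, Finset.mul_sum]
      refine Finset.sum_congr rfl fun j _ => ?_
      rw [intervalIntegral.integral_const_mul, toeplitz, Matrix.of_apply, coeff_eq]
      ring
    · intro i _
      exact Continuous.intervalIntegrable (by fun_prop) _ _
  rw [key]
  refine mul_nonneg (by positivity) (intervalIntegral.integral_nonneg
    (by linarith [Real.pi_pos]) fun θ _ => ?_)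
  have := symbol_nonneg hα θ
  positivity

theorem toeplitz_posSemidef {α : ℝ} (hα : 0 ≤ α) (n : ℕ) : (toeplitz α n).PosSemidef := by
  refine Matrix.PosSemidef.of_dotProduct_mulVec_nonneg ?_ fun x => ?_
  · ext i j
    simp only [Matrix.conjTranspose_apply, toeplitz, Matrix.of_apply, star_trivial]
    rw [← coeff_neg, neg_sub]
  · simpa using toeplitz_quadratic_nonneg hα x

/-! ### The discrete norm and unconditional stability -/

namespace Problem

variable (P : Problem)

theorem dt_pos {M : ℕ} (hM : 0 < M) : 0 < P.dt M :=
  div_pos P.hT (by exact_mod_cast hM)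

theorem hX_pos (N : ℕ) : 0 < P.hX N :=
  div_pos (sub_pos.2 P.hx) (by positivity)

theorem hY_pos (N : ℕ) : 0 < P.hY N :=
  div_pos (sub_pos.2 P.hy) (by positivity)

theorem J_posSemidef (M Nx Ny : ℕ) : (P.J M Nx Ny).PosSemidef := by
  have hα : 0 ≤ P.α := by linarith [P.hα.1]
  have hβ : 0 ≤ P.β := by linarith [P.hβ.1]
  have hx := P.hX_pos Nx
  have hy := P.hY_pos Ny
  have hdt : 0 ≤ P.dt M := div_nonneg P.hT.le (by positivity)
  have := P.hKα
  have := P.hKβ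
  refine Matrix.PosSemidef.add ?_ ?_
  · exact (Matrix.PosSemidef.one.kronecker (toeplitz_posSemidef hα Nx)).smul (by positivity)
  · exact ((toeplitz_posSemidef hβ Ny).kronecker Matrix.PosSemidef.one).smul (by positivity)

theorem discNorm_eq (Nx Ny : ℕ) (V : Fin Ny × Fin Nx → ℝ) :
    P.discNorm Nx Ny V = √(P.hX Nx * P.hY Ny) * ‖WithLp.toLp 2 V‖ := by
  have h : (0 : ℝ) ≤ P.hX Nx * P.hY Ny := (mul_pos (P.hX_pos _) (P.hY_pos _)).le
  rw [discNorm, Real.sqrt_mul h, EuclideanSpace.norm_eq, Fintype.sum_prod_type_right]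
  simp

theorem discNorm_add_le (Nx Ny : ℕ) (V W : Fin Ny × Fin Nx → ℝ) :
    P.discNorm Nx Ny (V + W) ≤ P.discNorm Nx Ny V + P.discNorm Nx Ny W := by
  simp only [discNorm_eq, WithLp.toLp_add, ← mul_add]
  gcongr
  exact norm_add_le _ _

theorem discNorm_smul (Nx Ny : ℕ) {c : ℝ} (hc : 0 ≤ c) (V : Fin Ny × Fin Nx → ℝ) :
    P.discNorm Nx Ny (c • V) = c * P.discNorm Nx Ny V := by
  simp only [discNorm_eq, WithLp.toLp_smul, norm_smul, Real.norm_of_nonneg hc]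
  ring

theorem discNorm_mono {Nx Ny : ℕ} {V W : Fin Ny × Fin Nx → ℝ} (h : ∀ p, |V p| ≤ |W p|) :
    P.discNorm Nx Ny V ≤ P.discNorm Nx Ny W := by
  have h0 : (0 : ℝ) ≤ P.hX Nx * P.hY Ny := (mul_pos (P.hX_pos _) (P.hY_pos _)).le
  refine Real.sqrt_le_sqrt (mul_le_mul_of_nonneg_left ?_ h0)
  exact Finset.sum_le_sum fun i _ => Finset.sum_le_sum fun j _ => sq_le_sq.2 (h _)

/-- Since `N_x h_x` and `N_y h_y` are at most the side lengths, the constant is the root of the area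
of `Ω`, whatever the mesh. -/
theorem discNorm_le_of_abs_le {Nx Ny : ℕ} {V : Fin Ny × Fin Nx → ℝ} {r : ℝ} (hr : 0 ≤ r)
    (h : ∀ p, |V p| ≤ r) :
    P.discNorm Nx Ny V ≤ √((P.xR - P.xL) * (P.yU - P.yD)) * r := by
  refine (P.discNorm_mono (W := fun _ => r) fun p => (h p).trans (le_abs_self r)).trans ?_
  rw [discNorm, ← Real.sqrt_sq hr, ← Real.sqrt_mul' _ (sq_nonneg _)]
  refine Real.sqrt_le_sqrt ?_
  simp only [Finset.sum_const, Finset.card_univ, Fintype.card_fin, nsmul_eq_mul,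
    Real.sqrt_sq hr]
  have h1 : P.hX Nx * Nx ≤ P.xR - P.xL := by
    rw [hX, div_mul_eq_mul_div, div_le_iff₀ (by positivity)]
    nlinarith [P.hx]
  have h2 : P.hY Ny * Ny ≤ P.yU - P.yD := by
    rw [hY, div_mul_eq_mul_div, div_le_iff₀ (by positivity)]
    nlinarith [P.hy]
  have h3 := mul_le_mul h1 h2 (mul_nonneg (P.hY_pos _).le (by positivity)) (sub_nonneg.2 P.hx.le)
  nlinarith [sq_nonneg r]

/-- One step of the scheme is a contraction up to its right-hand side. -/
theorem discNorm_step {M Nx Ny : ℕ} {V W G : Fin Ny × Fin Nx → ℝ}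
    (h : (1 + P.J M Nx Ny) *ᵥ V = (1 - P.J M Nx Ny) *ᵥ W + G) :
    P.discNorm Nx Ny V ≤ P.discNorm Nx Ny W + P.discNorm Nx Ny G := by
  have key : ‖WithLp.toLp 2 V‖ ≤ ‖WithLp.toLp 2 W‖ + ‖WithLp.toLp 2 G‖ := by
    -- The step reads `V - W + J (V + W) = G`; pairing with `V + W` gives `‖V‖² - ‖W‖² ≤ (V + W) ⬝ᵥ
    -- G`.
    have hJ := (P.J_posSemidef M Nx Ny).dotProduct_mulVec_nonneg (V + W)
    rw [star_trivial] at hJ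
    have hG : G = V - W + P.J M Nx Ny *ᵥ (V + W) := by
      rw [Matrix.add_mulVec, Matrix.sub_mulVec, Matrix.one_mulVec, Matrix.one_mulVec] at h
      rw [Matrix.mulVec_add]
      linear_combination (exp := 1) -h
    have h1 : (V + W) ⬝ᵥ (V - W) ≤ (V + W) ⬝ᵥ G := by
      rw [hG, dotProduct_add]
      linarith
    have h2 : (V + W) ⬝ᵥ (V - W) = ‖WithLp.toLp 2 V‖ ^ 2 - ‖WithLp.toLp 2 W‖ ^ 2 := by
      rw [EuclideanSpace.norm_sq_eq, EuclideanSpace.norm_sq_eq, ← Finset.sum_sub_distrib]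
      refine Finset.sum_congr rfl fun p _ => ?_
      simp
      ring
    have h3 : (V + W) ⬝ᵥ G ≤ (‖WithLp.toLp 2 V‖ + ‖WithLp.toLp 2 W‖) * ‖WithLp.toLp 2 G‖ := by
      have := real_inner_le_norm (WithLp.toLp 2 G) (WithLp.toLp 2 (V + W))
      rw [EuclideanSpace.inner_toLp_toLp, star_trivial, WithLp.toLp_add] at this
      refine this.trans ?_
      rw [mul_comm]
      gcongr
      exact norm_add_le _ _
    -- Arguing by contradiction makes `‖V‖ + ‖W‖` positive, so that it can be cancelled from `‖V‖² -
    -- ‖W‖² ≤ (‖V‖ + ‖W‖)‖G‖`.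
    by_contra hcon
    push Not at hcon
    have hV := norm_nonneg (WithLp.toLp 2 V)
    have hW := norm_nonneg (WithLp.toLp 2 W)
    have hG' := norm_nonneg (WithLp.toLp 2 G)
    nlinarith
  simp only [discNorm_eq, ← mul_add]
  gcongr

end Problem

/-! ### Discrete Gronwall inequality -/

/-- A discrete Gronwall inequality for a two-step recursion whose first step carries an extra
perturbation `E`. -/
theorem discrete_gronwall {a : ℕ → ℝ} {M : ℕ} {δ L ρ E : ℝ} (hδ : 0 ≤ δ * L)
    (hρ : 0 ≤ ρ) (hE : 0 ≤ E) (h0 : a 0 = 0)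
    (hstep : ∀ m < M, a (m + 1) ≤
      a m + δ * L * (3 / 2 * a m + 1 / 2 * a (m - 1)) + ρ + if m = 0 then E else 0) :
    ∀ m ≤ M, a m ≤ (E + m * ρ) * (1 + 2 * (δ * L)) ^ m := by
  set q := δ * L with hq
  have hpow : ∀ m : ℕ, 1 ≤ (1 + 2 * q) ^ m := fun m => one_le_pow₀ (by linarith)
  -- The recursion looks back two steps, so the induction carries the bound for the preceding term
  -- as well; at `m = 0` that term is again `a 0`.
  suffices H : ∀ m : ℕ, m ≤ M → a m ≤ (E + m * ρ) * (1 + 2 * q) ^ m ∧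
      a (m - 1) ≤ (E + m * ρ) * (1 + 2 * q) ^ m from fun m hm => (H m hm).1
  intro m
  induction m with
  | zero => intro _; simp [h0, hE]
  | succ m ih =>
    intro hm
    obtain ⟨h1, h2⟩ := ih (by omega)
    have hs := hstep m (by omega)
    have hp := hpow m
    have hA : 0 ≤ (E + m * ρ) * (1 + 2 * q) ^ m := by positivity
    have hA' : (E + m * ρ) * (1 + 2 * q) ^ m + ρ ≤
        (E + (m + 1 : ℕ) * ρ) * (1 + 2 * q) ^ m := by
      push_cast
      nlinarith
    have hmono : (E + (m + 1 : ℕ) * ρ) * (1 + 2 * q) ^ m ≤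
        (E + (m + 1 : ℕ) * ρ) * (1 + 2 * q) ^ (m + 1) := by
      gcongr
      · linarith
      · omega
    refine ⟨?_, by simpa using h1.trans ((le_add_of_nonneg_right hρ).trans (hA'.trans hmono))⟩
    have hp' := hpow (m + 1)
    -- On the first step `a 0 = 0` removes everything but `ρ + E`; afterwards `3/2 + 1/2 = 2`
    -- produces the factor `1 + 2q`.
    by_cases h00 : m = 0
    · subst h00
      simp only [Nat.zero_add, h0, Nat.zero_sub, if_true] at hs hp' ⊢
      push_cast
      nlinarith
    · simp only [if_neg h00] at hs
      have h3 : a (m + 1) ≤ (1 + 2 * q) * ((E + m * ρ) * (1 + 2 * q) ^ m) + ρ := by nlinarith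
      refine h3.trans ?_
      push_cast
      rw [pow_succ]
      nlinarith [mul_nonneg hρ hδ, hpow (m+1), pow_succ (1 + 2 * q) m]

/-! ### Fourth-order expansion of the symbol -/

theorem symbol_abs (α θ : ℝ) : symbol α |θ| = symbol α θ := by
  simp [symbol, Real.cos_abs]

/-- The half-angle formula `2 - 2 cos 2φ = (2 sin φ)²` reduces the expansion of the symbol to that
of `sin φ / φ`. -/
theorem symbol_two_mul {α φ : ℝ} (hs : 0 ≤ Real.sin φ) :
    symbol α (2 * φ) = (1 + α / 6 * Real.sin φ ^ 2) * (2 * Real.sin φ) ^ α := by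
  have h : 2 - 2 * Real.cos (2 * φ) = (2 * Real.sin φ) ^ (2 : ℝ) := by
    rw [Real.cos_two_mul, Real.rpow_two, mul_pow, Real.sin_sq]
    ring
  have h' : (2 * Real.sin φ) ^ (2 : ℝ) = 4 * Real.sin φ ^ 2 := by
    rw [Real.rpow_two]
    ring
  rw [symbol, h, ← Real.rpow_mul (by positivity), h']
  ring_nf

/-- Second-order expansion of `(1 - w) ^ α` for `1 ≤ α ≤ 2`. -/
theorem one_sub_rpow_bounds {α w : ℝ} (h1 : 1 ≤ α) (h2 : α ≤ 2) (hw1 : w < 1) :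
    1 - α * w ≤ (1 - w) ^ α ∧ (1 - w) ^ α ≤ 1 - α * w + w ^ 2 := by
  constructor
  · have := one_add_mul_self_le_rpow_one_add (s := -w) (by linarith) h1
    simpa [sub_eq_add_neg] using this
  -- Bernoulli's inequality for the exponent `α - 1 ∈ [0, 1]`, multiplied by `1 - w`, leaves the
  -- quadratic term `(α - 1) w² ≤ w²`.
  · have h := rpow_one_add_le_one_add_mul_self (s := -w) (by linarith)
      (p := α - 1) (by linarith) (by linarith)
    rw [← sub_eq_add_neg] at h
    have h3 : (1 - w) ^ α = (1 - w) ^ (α - 1) * (1 - w) := by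
      rw [← Real.rpow_add_one (by linarith)]
      ring_nf
    rw [h3]
    nlinarith [mul_le_mul_of_nonneg_right h (by linarith : (0 : ℝ) ≤ 1 - w)]

/-- Here `r` stands for `sin φ / φ`. Then `r ^ α = 1 - αφ²/6 + O(φ⁴)` while the other factor is `1 +
αφ²/6 + O(φ⁴)`: the quadratic terms cancel, which is why the scheme uses the constant `α/24`. -/
theorem normalized_symbol_bound {α φ r : ℝ} (h1 : 1 ≤ α) (h2 : α ≤ 2) (hφ : 0 ≤ φ) (hφ1 : φ ≤ 1)
    (hr : |r - (1 - φ ^ 2 / 6)| ≤ φ ^ 4 / 100) (hr1 : r ≤ 1) :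
    |(1 + α / 6 * (φ * r) ^ 2) * r ^ α - 1| ≤ 2 * φ ^ 4 := by
  obtain ⟨e, rfl⟩ : ∃ e, r = 1 - φ ^ 2 / 6 + e := ⟨r - (1 - φ ^ 2 / 6), by ring⟩
  rw [add_sub_cancel_left, abs_le] at hr
  obtain ⟨he1, he2⟩ := hr
  obtain ⟨x, hx⟩ : ∃ x, x = φ ^ 2 := ⟨_, rfl⟩
  rw [← hx] at hr1
  have hx0 : 0 ≤ x := hx ▸ sq_nonneg φ
  have hx1 : x ≤ 1 := by nlinarith
  have h4 : φ ^ 4 = x ^ 2 := by rw [hx]; ring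
  rw [h4] at he1 he2 ⊢
  rw [← hx]
  obtain ⟨w, hw⟩ : ∃ w, w = x / 6 - e := ⟨_, rfl⟩
  have hrw : 1 - x / 6 + e = 1 - w := by rw [hw]; ring
  rw [hrw] at hr1 ⊢
  have hw0 : 0 ≤ w := by linarith
  have hwx : w ≤ x / 5 := by nlinarith
  obtain ⟨hb1, hb2⟩ := one_sub_rpow_bounds (w := w) h1 h2 (by linarith)
  obtain ⟨k, hk⟩ : ∃ k, (1 - w) ^ α = 1 - α * x / 6 + k := ⟨(1 - w) ^ α - (1 - α * x / 6), by ring⟩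
  have hk1 : -(x ^ 2 / 10) ≤ k := by rw [hk, hw] at hb1; nlinarith
  have hk2 : k ≤ x ^ 2 / 10 := by
    rw [hk] at hb2
    have : w ^ 2 ≤ x ^ 2 / 25 := by nlinarith
    have : α * w = α * x / 6 - α * e := by rw [hw]; ring
    nlinarith
  rw [hk, mul_pow, ← hx]
  obtain ⟨g, hg⟩ : ∃ g, α / 6 * (x * (1 - w) ^ 2) = α * x / 6 - g :=
    ⟨α * x / 6 - α / 6 * (x * (1 - w) ^ 2), by ring⟩
  have hg' : g = α / 6 * x * (2 * w - w ^ 2) := by linear_combination hg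
  have hq0 : 0 ≤ 2 * w - w ^ 2 := by nlinarith
  have hq1 : 2 * w - w ^ 2 ≤ 2 / 5 * x := by nlinarith
  have hg0 : 0 ≤ g := by rw [hg']; positivity
  have hg1 : g ≤ x ^ 2 / 5 := by
    rw [hg']
    have : α / 6 * x ≤ x / 3 := by nlinarith
    nlinarith [mul_le_mul this hq1 hq0 (by positivity)]
  rw [hg]
  obtain ⟨p, hp⟩ : ∃ p, p = α * x / 6 := ⟨_, rfl⟩
  have hp0 : 0 ≤ p := by rw [hp]; positivity
  have hp1 : p ≤ x / 3 := by rw [hp]; nlinarith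
  rw [← hp]
  have hpp : p ^ 2 ≤ x ^ 2 / 9 := by nlinarith
  have hk' : |k| ≤ x ^ 2 / 10 := abs_le.2 ⟨hk1, hk2⟩
  have hg2 : g ≤ 1 := by nlinarith
  have hpk : |p * k| ≤ 1 * (x ^ 2 / 10) := by
    rw [abs_mul, abs_of_nonneg hp0]
    exact mul_le_mul (by linarith) hk' (abs_nonneg k) zero_le_one
  have hgp : |p * g| ≤ 1 * (x ^ 2 / 5) := by
    rw [abs_mul, abs_of_nonneg hp0, abs_of_nonneg hg0]
    exact mul_le_mul (by linarith) hg1 hg0 zero_le_one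
  have hgk : |g * k| ≤ 1 * (x ^ 2 / 10) := by
    rw [abs_mul, abs_of_nonneg hg0]
    exact mul_le_mul hg2 hk' (abs_nonneg k) zero_le_one
  -- No term linear in `p` survives; each remaining one is at most a multiple of `x² = φ⁴`.
  have hexp : (1 + (p - g)) * (1 - p + k) - 1 = -p ^ 2 + k + p * k - g + p * g - g * k := by ring
  rw [abs_le] at hpk hgp hgk ⊢
  have hx2 := sq_nonneg x
  have hp2 := sq_nonneg p
  rw [hexp]
  constructor <;> linarith [hpk.1, hpk.2, hgp.1, hgp.2, hgk.1, hgk.2]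

/-- A crude bound, used for large angles and for the integrability of the discrete multiplier. -/
theorem symbol_le_eight {α : ℝ} (h1 : 1 ≤ α) (h2 : α ≤ 2) (t : ℝ) : symbol α t ≤ 8 := by
  have hc : 2 - 2 * Real.cos t ≤ 4 := by linarith [Real.neg_one_le_cos t]
  have hc0 := two_sub_two_cos_nonneg t
  have hp : (2 - 2 * Real.cos t) ^ (α / 2) ≤ 4 := by
    calc (2 - 2 * Real.cos t) ^ (α / 2) ≤ 4 ^ (α / 2) :=
          Real.rpow_le_rpow hc0 hc (by positivity)
      _ ≤ (4 : ℝ) ^ (1 : ℝ) :=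
          Real.rpow_le_rpow_of_exponent_le (by norm_num) (by linarith)
      _ = 4 := Real.rpow_one 4
  have hq : 1 + α / 24 * (2 - 2 * Real.cos t) ≤ 2 := by nlinarith
  calc symbol α t ≤ 2 * 4 :=
        mul_le_mul hq hp (Real.rpow_nonneg hc0 _) (by norm_num)
    _ = 8 := by norm_num

/-- The symbol of the scheme agrees with `|θ| ^ α` to relative order four. -/
theorem abs_symbol_sub_le {α : ℝ} (h1 : 1 ≤ α) (h2 : α ≤ 2) (θ : ℝ) :
    |symbol α θ - |θ| ^ α| ≤ |θ| ^ (4 + α) := by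
  rw [← symbol_abs]
  rcases eq_or_ne θ 0 with rfl | hθ
  · have h3 : α / 2 ≠ 0 := by linarith
    have h4 : α ≠ 0 := by linarith
    simp [symbol, Real.zero_rpow h3, Real.zero_rpow h4, Real.zero_rpow_nonneg]
  have ht : 0 < |θ| := abs_pos.2 hθ
  set t := |θ| with htdef
  have hsplit : t ^ (4 + α) = t ^ 4 * t ^ α := by
    rw [Real.rpow_add ht]
    norm_cast
  -- For `t ≤ 2` the half angle is at most `1`, where the Taylor bound for the sine applies. For `t
  -- > 2` the claim is crude, because `t ^ 4 ≥ 16` while the symbol is at most `8` and `t ^ α ≥ 1`.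
  rcases le_or_gt t 2 with ht2 | ht2
  · obtain ⟨φ, hφ⟩ : ∃ φ, t = 2 * φ := ⟨t / 2, by ring⟩
    have hφ0 : 0 < φ := by linarith
    have hφ1 : φ ≤ 1 := by linarith
    have hs0 : 0 ≤ Real.sin φ :=
      Real.sin_nonneg_of_nonneg_of_le_pi hφ0.le (by linarith [Real.pi_gt_three])
    obtain ⟨r, hr⟩ : ∃ r, Real.sin φ = φ * r := ⟨Real.sin φ / φ, by field_simp⟩
    have hr0 : 0 ≤ r := by
      rw [hr] at hs0
      exact nonneg_of_mul_nonneg_right hs0 hφ0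
    have hr1 : r ≤ 1 := by
      have := Real.sin_le hφ0.le
      rw [hr] at this
      nlinarith
    have hrb : |r - (1 - φ ^ 2 / 6)| ≤ φ ^ 4 / 100 := by
      have h := Real.sin_bound (x := φ) (by rwa [abs_of_pos hφ0])
      rw [hr, abs_of_pos hφ0] at h
      have h' : φ * r - (φ - φ ^ 3 / 6) = φ * (r - (1 - φ ^ 2 / 6)) := by ring
      rw [h', abs_mul, abs_of_pos hφ0] at h
      refine le_of_mul_le_mul_left (h.trans_eq ?_) hφ0
      ring
    have hb := normalized_symbol_bound h1 h2 hφ0.le hφ1 hrb hr1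
    have hsym : symbol α t - t ^ α = t ^ α * ((1 + α / 6 * (φ * r) ^ 2) * r ^ α - 1) := by
      rw [hφ, symbol_two_mul hs0, hr, ← mul_assoc, Real.mul_rpow (by positivity) hr0]
      ring
    rw [hsym, abs_mul, abs_of_nonneg (by positivity), hsplit, mul_comm]
    gcongr
    refine hb.trans ?_
    rw [hφ]
    nlinarith [pow_pos hφ0 4]
  · have hα0 : 0 ≤ α := by linarith
    have hS0 := symbol_nonneg hα0 t
    have hS1 := symbol_le_eight h1 h2 t
    have hta : 1 ≤ t ^ α := Real.one_le_rpow (by linarith) hα0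
    have ht4 : 16 ≤ t ^ 4 := by
      calc (16 : ℝ) = 2 ^ 4 := by norm_num
        _ ≤ t ^ 4 := by gcongr
    rw [hsplit, abs_le]
    constructor <;> nlinarith

/-- The symbol on the grid of width `h`, compared with `|ξ| ^ α`. -/
theorem abs_scaled_symbol_sub_le {α h : ℝ} (h1 : 1 ≤ α) (h2 : α ≤ 2) (hh : 0 < h) (ξ : ℝ) :
    |symbol α (h * ξ) / h ^ α - |ξ| ^ α| ≤ h ^ 4 * |ξ| ^ (4 + α) := by
  have h3 : 0 < h ^ α := Real.rpow_pos_of_pos hh _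
  have h4 := abs_symbol_sub_le h1 h2 (h * ξ)
  rw [abs_mul, abs_of_pos hh, Real.mul_rpow hh.le (abs_nonneg _),
    Real.mul_rpow hh.le (abs_nonneg _), Real.rpow_add hh] at h4
  have h5 : symbol α (h * ξ) / h ^ α - |ξ| ^ α =
      (symbol α (h * ξ) - h ^ α * |ξ| ^ α) / h ^ α := by
    field_simp
  rw [h5, abs_div, abs_of_pos h3, div_le_iff₀ h3]
  refine h4.trans_eq ?_
  norm_cast
  ring

/-! ### Toeplitz matrices as Fourier multipliers -/

/-- The functional `φ ↦ ∫ g · (φ ∘ τ)` on continuous functions on a compact space. -/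
noncomputable def pullbackIntegral {X Y : Type*} [TopologicalSpace X] [MeasurableSpace X]
    [OpensMeasurableSpace X] [TopologicalSpace Y] [CompactSpace Y] (μ : Measure X) {g : X → ℂ}
    (hg : Integrable g μ) (τ : C(X, Y)) : C(Y, ℂ) →L[ℂ] ℂ :=
  have hi : ∀ φ : C(Y, ℂ), Integrable (fun x => g x * φ (τ x)) μ := fun φ =>
    hg.mul_bdd (c := ‖φ‖) (φ.comp τ).continuous.aestronglyMeasurable
      (Filter.Eventually.of_forall fun x => φ.norm_coe_le_norm _)
  LinearMap.mkContinuous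
    { toFun := fun φ => ∫ x, g x * φ (τ x) ∂μ
      map_add' := fun φ ψ => by
        simp only [ContinuousMap.add_apply, mul_add]
        exact integral_add (hi φ) (hi ψ)
      map_smul' := fun c φ => by
        simp only [ContinuousMap.smul_apply, smul_eq_mul, RingHom.id_apply, mul_left_comm _ c]
        exact integral_const_mul _ _ }
    (∫ x, ‖g x‖ ∂μ)
    fun φ => by
      rw [← integral_mul_const]
      refine norm_integral_le_of_norm_le (hg.norm.mul_const _)
        (Filter.Eventually.of_forall fun x => ?_)
      rw [norm_mul]
      gcongr
      exact φ.norm_coe_le_norm _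

theorem pullbackIntegral_apply {X Y : Type*} [TopologicalSpace X] [MeasurableSpace X]
    [OpensMeasurableSpace X] [TopologicalSpace Y] [CompactSpace Y] (μ : Measure X) {g : X → ℂ}
    (hg : Integrable g μ) (τ : C(X, Y)) (φ : C(Y, ℂ)) :
    pullbackIntegral μ hg τ φ = ∫ x, g x * φ (τ x) ∂μ := rfl

instance : Fact (0 < 2 * Real.pi) := ⟨Real.two_pi_pos⟩

/-- The trigonometric integral `∫ g(η) e^{2πiηx} dη`. -/
noncomputable def waveIntegral (g : ℝ → ℂ) (x : ℝ) : ℂ :=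
  ∫ η : ℝ, Complex.exp (2 * Real.pi * η * x * Complex.I) * g η

theorem integrable_wave {g : ℝ → ℂ} (hg : Integrable g) (x : ℝ) :
    Integrable fun η : ℝ => Complex.exp (2 * Real.pi * η * x * Complex.I) * g η := by
  refine hg.bdd_mul (c := 1) (by fun_prop) (Filter.Eventually.of_forall fun η => ?_)
  rw [← Complex.ofReal_ofNat, ← Complex.ofReal_mul, ← Complex.ofReal_mul, ← Complex.ofReal_mul,
    Complex.norm_exp_ofReal_mul_I]

/-- A discrete convolution of a continuous function's Fourier coefficients with samples of a
trigonometric integral acts on the latter as a Fourier multiplier. Only finitely many samples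
are allowed to be non-zero, so that summability of the coefficients is not an issue. -/
theorem sum_fourierCoeff_mul_waveIntegral {g : ℝ → ℂ} (hg : Integrable g) (x h : ℝ)
    (F : Finset ℤ) (hF : ∀ k ∉ F, waveIntegral g (x - k * h) = 0)
    (φ : C(AddCircle (2 * Real.pi), ℂ)) :
    ∑ k ∈ F, fourierCoeff φ k * waveIntegral g (x - k * h) =
      ∫ η : ℝ, Complex.exp (2 * Real.pi * η * x * Complex.I) * g η *
        φ ((-(h * (2 * Real.pi * η)) : ℝ) : AddCircle (2 * Real.pi)) := by
  let τ : C(ℝ, AddCircle (2 * Real.pi)) :=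
    ⟨fun η => ((-(h * (2 * Real.pi * η)) : ℝ) : AddCircle (2 * Real.pi)),
      by
        exact (AddCircle.continuous_mk' _).comp (by fun_prop)⟩
  have hfi : ∀ k : ℤ, Integrable (fun y => fourier (-k) y)
      (AddCircle.haarAddCircle (T := 2 * Real.pi)) := fun k =>
    (map_continuous (fourier (T := 2 * Real.pi) (-k))).integrable_of_hasCompactSupport
      (HasCompactSupport.of_compactSpace _)
  -- Both sides are functionals of `φ` continuous in the supremum norm, so it is enough to compare
  -- them on the characters, whose span is dense.
  let Λ₁ : C(AddCircle (2 * Real.pi), ℂ) →L[ℂ] ℂ := ∑ k ∈ F, waveIntegral g (x - k * h) •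
    pullbackIntegral AddCircle.haarAddCircle (hfi k) (ContinuousMap.id _)
  let Λ₂ := pullbackIntegral volume (integrable_wave hg x) τ
  have h1 : ∀ ψ : C(AddCircle (2 * Real.pi), ℂ),
      Λ₁ ψ = ∑ k ∈ F, fourierCoeff ψ k * waveIntegral g (x - k * h) := by
    intro ψ
    simp only [Λ₁, sum_apply, smul_apply,
      pullbackIntegral_apply, fourierCoeff, smul_eq_mul, ContinuousMap.id_apply]
    exact Finset.sum_congr rfl fun k _ => mul_comm _ _
  have h2 : Λ₁ = Λ₂ := by
    refine ContinuousLinearMap.ext_on (s := Set.range (@fourier (2 * Real.pi))) ?_ ?_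
    · exact Submodule.dense_iff_topologicalClosure_eq_top.2 span_fourier_closure_eq_top
    · rintro _ ⟨n, rfl⟩
      rw [h1]
      have hcn : ∀ k, fourierCoeff (fourier (T := 2 * Real.pi) n) k = if k = n then 1 else 0 := by
        intro k
        rw [fourierCoeff_fourier, Pi.single_apply]
      -- At the angle `-2πhη` the character `fourier n` is a phase that translates `x` to `x - nh`.
      have h3 : Λ₂ (fourier n) = waveIntegral g (x - n * h) := by
        simp only [Λ₂, pullbackIntegral_apply, waveIntegral]
        refine integral_congr_ae (Filter.Eventually.of_forall fun η => ?_)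
        have hpi : (Real.pi : ℂ) ≠ 0 := by exact_mod_cast Real.pi_ne_zero
        change Complex.exp (2 * Real.pi * η * x * Complex.I) * g η *
          fourier n ((-(h * (2 * Real.pi * η)) : ℝ) : AddCircle (2 * Real.pi)) = _
        rw [fourier_coe_apply, mul_right_comm, ← Complex.exp_add]
        congr 2
        push_cast
        field_simp
        ring
      rw [h3]
      simp only [hcn, ite_mul, one_mul, zero_mul, Finset.sum_ite_eq']
      split_ifs with hn
      · rfl
      · exact (hF n hn).symm
  rw [← h1, h2]
  rfl

theorem symbol_periodic (α : ℝ) :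
    Function.Periodic (fun θ => (symbol α θ : ℂ)) (2 * Real.pi) := fun θ => by
  simp [symbol, Real.cos_add_two_pi]

/-- The symbol as a continuous function on the circle. -/
noncomputable def circleSymbol {α : ℝ} (hα : 0 ≤ α) : C(AddCircle (2 * Real.pi), ℂ) :=
  ⟨(symbol_periodic α).lift, by
    refine continuous_coinduced_dom.mpr ?_
    exact Complex.continuous_ofReal.comp (continuous_symbol hα)⟩

theorem circleSymbol_coe {α : ℝ} (hα : 0 ≤ α) (θ : ℝ) :
    circleSymbol hα (θ : AddCircle (2 * Real.pi)) = symbol α θ := rfl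

/-- The symbol is even, so the sine part of the Fourier coefficient integrates to zero. -/
theorem fourierCoeff_circleSymbol {α : ℝ} (hα : 0 ≤ α) (k : ℤ) :
    fourierCoeff (circleSymbol hα) k = coeff α k := by
  have hc := continuous_symbol hα
  have hpi : (Real.pi : ℂ) ≠ 0 := by exact_mod_cast Real.pi_ne_zero
  rw [fourierCoeff_eq_intervalIntegral _ k (-Real.pi), show -Real.pi + 2 * Real.pi = Real.pi by ring]
  have h1 : ∀ θ : ℝ, fourier (-k) (θ : AddCircle (2 * Real.pi)) •
      circleSymbol hα (θ : AddCircle (2 * Real.pi)) =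
      ((symbol α θ * Real.cos (k * θ) : ℝ) : ℂ) -
        ((symbol α θ * Real.sin (k * θ) : ℝ) : ℂ) * Complex.I := by
    intro θ
    rw [circleSymbol_coe, fourier_coe_apply]
    have : 2 * (Real.pi : ℂ) * Complex.I * ((-k : ℤ) : ℂ) * (θ : ℂ) / ((2 * Real.pi : ℝ) : ℂ) =
        ((-(k * θ) : ℝ) : ℂ) * Complex.I := by
      push_cast
      field_simp
    rw [this, Complex.exp_mul_I, ← Complex.ofReal_cos, ← Complex.ofReal_sin, Real.cos_neg,
      Real.sin_neg, smul_eq_mul]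
    push_cast
    ring
  have hodd : ∫ θ in (-Real.pi)..Real.pi, symbol α θ * Real.sin (k * θ) = 0 := by
    have := intervalIntegral.integral_comp_neg (a := -Real.pi) (b := Real.pi)
      (fun θ => symbol α θ * Real.sin (k * θ))
    simp only [← symbol_abs α (-_), abs_neg, symbol_abs, mul_neg, Real.sin_neg,
      intervalIntegral.integral_neg, neg_neg] at this
    linarith
  simp_rw [h1]
  rw [intervalIntegral.integral_sub (Continuous.intervalIntegrable (by fun_prop) _ _)
    (Continuous.intervalIntegrable (by fun_prop) _ _), intervalIntegral.integral_mul_const,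
    intervalIntegral.integral_ofReal, intervalIntegral.integral_ofReal, hodd, coeff_eq]
  push_cast
  simp

/-- The Toeplitz matrix applied to grid samples of a compactly supported trigonometric integral. -/
theorem toeplitz_mulVec_eq {α : ℝ} (hα : 0 ≤ α) {g : ℝ → ℂ} (hg : Integrable g) {v : ℝ → ℝ}
    (hv : ∀ x, (v x : ℂ) = waveIntegral g x) {a h : ℝ} {N : ℕ} (hh : 0 < h)
    (hout : ∀ x, x ∉ Set.Ioo a (a + (N + 1) * h) → v x = 0) (i : Fin N) :
    (((toeplitz α N *ᵥ fun j => v (a + ((j : ℝ) + 1) * h)) i : ℝ) : ℂ) =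
      ∫ η : ℝ, Complex.exp (2 * Real.pi * η * (a + ((i : ℝ) + 1) * h : ℝ) * Complex.I) * g η *
        symbol α (h * (2 * Real.pi * η)) := by
  have hinj : Function.Injective fun j : Fin N => (i : ℤ) - (j : ℤ) := by
    intro j k hjk
    ext
    have : (i : ℤ) - (j : ℤ) = (i : ℤ) - (k : ℤ) := hjk
    omega
  have key := sum_fourierCoeff_mul_waveIntegral hg (a + ((i : ℝ) + 1) * h) h
    (Finset.univ.map ⟨fun j : Fin N => (i : ℤ) - (j : ℤ), hinj⟩) ?_ (circleSymbol hα)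
  · simp only [circleSymbol_coe, ← symbol_abs α (-_), abs_neg, symbol_abs] at key
    rw [← key, Finset.sum_map, Matrix.mulVec, dotProduct]
    push_cast
    refine Finset.sum_congr rfl fun j _ => ?_
    rw [fourierCoeff_circleSymbol, toeplitz, Matrix.of_apply, hv]
    simp only [Function.Embedding.coeFn_mk]
    congr 2
    push_cast
    ring
  · intro k hk
    rw [← hv, hout, Complex.ofReal_zero]
    rintro ⟨h1, h2⟩
    apply hk
    -- The sample point is `a + (i + 1 - k) h`. If it lies in the open interval, then `0 < i + 1 - k
    -- < N + 1`, so `j = i - k` is an admissible index.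
    have e1 : (0 : ℝ) < (i : ℝ) + 1 - k := by
      by_contra hcon
      push Not at hcon
      nlinarith
    have e2 : (i : ℝ) + 1 - k < N + 1 := by
      by_contra hcon
      push Not at hcon
      nlinarith
    have e1' : (0 : ℤ) < (i : ℤ) + 1 - k := by exact_mod_cast e1
    have e2' : (i : ℤ) + 1 - k < N + 1 := by exact_mod_cast e2
    simp only [Finset.mem_map, Finset.mem_univ, true_and, Function.Embedding.coeFn_mk]
    refine ⟨⟨((i : ℤ) - k).toNat, by omega⟩, ?_⟩
    simp only
    omega

/-! ### Laplace transform of a power -/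

theorem integrableOn_rpow_mul_exp_neg_mul {s b : ℝ} (hs : -1 < s) (hb : 0 < b) :
    IntegrableOn (fun t : ℝ => t ^ s * Real.exp (-b * t)) (Set.Ioi 0) := by
  simpa using integrableOn_rpow_mul_exp_neg_mul_rpow (p := 1) hs one_pos hb

theorem norm_rpow_mul_cexp {s t : ℝ} (ht : 0 < t) (z : ℂ) :
    ‖((t ^ s : ℝ) : ℂ) * Complex.exp (-(z * t))‖ = t ^ s * Real.exp (-z.re * t) := by
  rw [norm_mul, Complex.norm_real, Complex.norm_exp,
    Real.norm_of_nonneg (Real.rpow_nonneg ht.le _)]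
  simp

theorem integrableOn_rpow_mul_cexp {s : ℝ} (hs : -1 < s) {z : ℂ} (hz : 0 < z.re) :
    IntegrableOn (fun t : ℝ => ((t ^ s : ℝ) : ℂ) * Complex.exp (-(z * t))) (Set.Ioi 0) := by
  refine (integrableOn_rpow_mul_exp_neg_mul hs hz).mono' ?_ ?_
  · exact Measurable.aestronglyMeasurable (by fun_prop)
  · filter_upwards [ae_restrict_mem measurableSet_Ioi] with t ht
    exact (norm_rpow_mul_cexp ht z).le

/-- The Laplace transform of `t ^ (s - 1)` is holomorphic in the right half plane. -/
theorem differentiableOn_laplace_rpow {s : ℝ} (hs : 0 < s) :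
    DifferentiableOn ℂ
      (fun z : ℂ => ∫ t in Set.Ioi (0 : ℝ), ((t ^ (s - 1) : ℝ) : ℂ) * Complex.exp (-(z * t)))
      {z | 0 < z.re} := by
  intro z hz
  have hz : 0 < z.re := hz
  refine DifferentiableAt.differentiableWithinAt ?_
  have hball : ∀ w ∈ Metric.ball z (z.re / 2), z.re / 2 ≤ w.re := by
    intro w hw
    have h1 := (Complex.abs_re_le_norm (w - z)).trans (mem_ball_iff_norm.1 hw).le
    rw [Complex.sub_re, abs_le] at h1
    linarith [h1.1]
  refine (hasDerivAt_integral_of_dominated_loc_of_deriv_le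
    (μ := volume.restrict (Set.Ioi (0 : ℝ)))
    (F := fun (w : ℂ) (t : ℝ) => ((t ^ (s - 1) : ℝ) : ℂ) * Complex.exp (-(w * t)))
    (F' := fun (w : ℂ) (t : ℝ) => ((t ^ (s - 1) : ℝ) : ℂ) * (Complex.exp (-(w * t)) * (-(1 * t))))
    (bound := fun t : ℝ => t ^ s * Real.exp (-(z.re / 2) * t))
    (Metric.ball_mem_nhds z (half_pos hz)) ?_ ?_ ?_ ?_ ?_ ?_).2.differentiableAt
  · exact Filter.Eventually.of_forall fun w => Measurable.aestronglyMeasurable (by fun_prop)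
  · exact integrableOn_rpow_mul_cexp (by linarith) hz
  · exact Measurable.aestronglyMeasurable (by fun_prop)
  · filter_upwards [ae_restrict_mem measurableSet_Ioi] with t ht w hw
    have ht : 0 < t := ht
    rw [← mul_assoc, norm_mul, norm_rpow_mul_cexp ht, norm_neg, one_mul, Complex.norm_real,
      Real.norm_of_nonneg ht.le, mul_right_comm, ← Real.rpow_add_one ht.ne', sub_add_cancel]
    gcongr
    exact hball w hw
  · exact integrableOn_rpow_mul_exp_neg_mul (by linarith) (half_pos hz)
  · refine Filter.Eventually.of_forall fun t w _ => ?_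
    exact ((((hasDerivAt_id w).mul_const (t : ℂ)).neg).cexp).const_mul _

/-- For real `z > 0` this is the rescaled Gamma integral. Both sides are holomorphic in the right
half plane, and the real points accumulate at `1`, so the identity theorem extends it. -/
theorem laplace_rpow {s : ℝ} (hs : 0 < s) {z : ℂ} (hz : 0 < z.re) :
    ∫ t in Set.Ioi (0 : ℝ), ((t ^ (s - 1) : ℝ) : ℂ) * Complex.exp (-(z * t)) =
      (1 / z) ^ (s : ℂ) * Real.Gamma s := by
  have hopen : IsOpen {z : ℂ | 0 < z.re} := isOpen_lt continuous_const Complex.continuous_re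
  have hconv : Convex ℝ {z : ℂ | 0 < z.re} := convex_halfSpace_re_gt 0
  have hG : DifferentiableOn ℂ (fun z : ℂ => (1 / z) ^ (s : ℂ) * (Real.Gamma s : ℂ))
      {z | 0 < z.re} := by
    intro w hw
    have hw : 0 < w.re := hw
    have hw0 : w ≠ 0 := fun h => by simp [h] at hw
    refine DifferentiableAt.differentiableWithinAt (DifferentiableAt.mul_const ?_ _)
    refine DifferentiableAt.cpow_const (by fun_prop (disch := exact hw0)) (Or.inl ?_)
    rw [one_div, Complex.inv_re]
    exact div_pos hw (Complex.normSq_pos.2 hw0)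
  refine ((differentiableOn_laplace_rpow hs).analyticOnNhd hopen).eqOn_of_preconnected_of_frequently_eq
    (hG.analyticOnNhd hopen) hconv.isPreconnected (z₀ := 1) (by simp) ?_ hz
  have htend : Filter.Tendsto (fun x : ℝ => (x : ℂ)) (nhdsWithin 1 {1}ᶜ) (nhdsWithin 1 {1}ᶜ) := by
    refine tendsto_nhdsWithin_iff.2 ⟨?_, ?_⟩
    · exact (Complex.continuous_ofReal.tendsto' (1 : ℝ) (1 : ℂ) (by simp)).mono_left
        nhdsWithin_le_nhds
    · filter_upwards [self_mem_nhdsWithin] with x hx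
      simpa using hx
  refine htend.frequently (Filter.Eventually.frequently ?_)
  filter_upwards [nhdsWithin_le_nhds (lt_mem_nhds (zero_lt_one (α := ℝ)))] with r hr
  have h := Complex.integral_cpow_mul_exp_neg_mul_Ioi (a := (s : ℂ)) (by simpa using hs) hr
  rw [Complex.Gamma_ofReal] at h
  rw [← h]
  refine setIntegral_congr_fun measurableSet_Ioi fun t ht => ?_
  have ht : 0 < t := ht
  rw [Complex.ofReal_cpow ht.le]
  push_cast
  rfl

/-! ### Trigonometric integrals and their derivatives -/

theorem waveIntegral_eq_fourier (g : ℝ → ℂ) (x : ℝ) : waveIntegral g x = 𝓕 g (-x) := by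
  rw [Real.fourier_real_eq_integral_exp_smul, waveIntegral]
  refine integral_congr_ae (Filter.Eventually.of_forall fun η => ?_)
  simp only [smul_eq_mul]
  congr 2
  push_cast
  ring

theorem waveIntegral_comp_neg (g : ℝ → ℂ) (x : ℝ) :
    waveIntegral (fun η => g (-η)) x = waveIntegral g (-x) := by
  rw [waveIntegral, waveIntegral, ← integral_neg_eq_self]
  refine integral_congr_ae (Filter.Eventually.of_forall fun η => ?_)
  simp

theorem norm_wave (η x : ℝ) : ‖Complex.exp (2 * Real.pi * η * x * Complex.I)‖ = 1 := by
  rw [← Complex.ofReal_ofNat, ← Complex.ofReal_mul, ← Complex.ofReal_mul, ← Complex.ofReal_mul,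
    Complex.norm_exp_ofReal_mul_I]

theorem continuous_waveIntegral {g : ℝ → ℂ} (hg : Integrable g) : Continuous (waveIntegral g) := by
  refine continuous_of_dominated (bound := fun η => ‖g η‖)
    (fun x => (integrable_wave hg x).aestronglyMeasurable) (fun x => ?_) hg.norm ?_
  · refine Filter.Eventually.of_forall fun η => ?_
    rw [norm_mul, norm_wave, one_mul]
  · exact Filter.Eventually.of_forall fun η => by fun_prop

theorem hasDerivAt_waveIntegral {g : ℝ → ℂ} (hg : Integrable g)
    (hg' : Integrable fun η : ℝ => (η : ℂ) * g η) (x : ℝ) :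
    HasDerivAt (waveIntegral g)
      (waveIntegral (fun η => 2 * Real.pi * Complex.I * (η * g η)) x) x := by
  have h := (Real.hasDerivAt_fourier hg hg' (-x)).scomp x (hasDerivAt_neg x)
  have h1 : waveIntegral g = 𝓕 g ∘ Neg.neg := funext fun y => waveIntegral_eq_fourier g y
  rw [h1]
  refine h.congr_deriv ?_
  rw [waveIntegral_eq_fourier, Real.fourier_real_eq_integral_exp_smul,
    Real.fourier_real_eq_integral_exp_smul, ← integral_smul]
  refine integral_congr_ae (Filter.Eventually.of_forall fun η => ?_)
  simp only [smul_eq_mul, Complex.real_smul]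
  push_cast
  ring

/-- A real function which is a trigonometric integral with two moments is `C²`, and its second
derivative is again a trigonometric integral. -/
theorem contDiff_two_of_waveIntegral {g : ℝ → ℂ} {v : ℝ → ℝ} (hv : ∀ x, (v x : ℂ) = waveIntegral g x)
    (hg : Integrable g) (hg1 : Integrable fun η : ℝ => (η : ℂ) * g η)
    (hg2 : Integrable fun η : ℝ => (η : ℂ) * (η * g η)) :
    ContDiff ℝ 2 v ∧ ∀ x, ((deriv (deriv v) x : ℝ) : ℂ) =
      waveIntegral (fun η => -(2 * Real.pi * η) ^ 2 * g η) x := by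
  -- The derivative of a real function computed in `ℂ` is itself real, so it may be read off as a
  -- real derivative.
  have real_deriv : ∀ {w : ℝ → ℝ} {G G' : ℝ → ℂ}, (∀ x, (w x : ℂ) = G x) →
      (∀ x, HasDerivAt G (G' x) x) → ∀ x, HasDerivAt w (G' x).re x ∧ ((deriv w x : ℝ) : ℂ) = G' x := by
    intro w G G' hw hG x
    have h1 : HasDerivAt w (G' x).re x := by
      have := (Complex.reCLM.hasFDerivAt.comp_hasDerivAt x (hG x))
      refine this.congr_of_eventuallyEq (Filter.Eventually.of_forall fun y => ?_)
      simp [← hw y]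
    refine ⟨h1, ?_⟩
    have h2 : HasDerivAt (fun y => (w y : ℂ)) ((G' x).re : ℂ) x := h1.ofReal_comp
    rw [funext hw] at h2
    rw [h1.deriv, h2.unique (hG x)]
  have hd1 := hasDerivAt_waveIntegral hg hg1
  have hi1 : Integrable fun η : ℝ => 2 * Real.pi * Complex.I * ((η : ℂ) * g η) := hg1.const_mul _
  have hi2 : Integrable fun η : ℝ => (η : ℂ) * (2 * Real.pi * Complex.I * (η * g η)) := by
    refine (hg2.const_mul (2 * Real.pi * Complex.I)).congr (Filter.Eventually.of_forall fun η => ?_)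
    simp only
    ring
  have hd2 := hasDerivAt_waveIntegral hi1 hi2
  have e1 := real_deriv hv hd1
  have e2 := real_deriv (fun x => (e1 x).2) hd2
  have hval : ∀ x, ((deriv (deriv v) x : ℝ) : ℂ) =
      waveIntegral (fun η => -(2 * Real.pi * η) ^ 2 * g η) x := by
    intro x
    rw [(e2 x).2]
    congr 1
    funext η
    linear_combination (4 * Real.pi ^ 2 * η ^ 2 * g η) * Complex.I_sq
  refine ⟨?_, hval⟩
  have hc : Continuous (deriv (deriv v)) := by
    have hi3 : Integrable fun η : ℝ => -(2 * Real.pi * η : ℂ) ^ 2 * g η := by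
      refine (hg2.const_mul (-(2 * Real.pi) ^ 2)).congr
        (Filter.Eventually.of_forall fun η => ?_)
      simp only
      ring
    have : deriv (deriv v) = fun x => (waveIntegral (fun η => -(2 * Real.pi * η) ^ 2 * g η) x).re := by
      funext x
      rw [← hval, Complex.ofReal_re]
    rw [this]
    exact Complex.continuous_re.comp (continuous_waveIntegral hi3)
  have h2 : ContDiff ℝ (1 + 1) v := by
    rw [contDiff_succ_iff_deriv]
    refine ⟨fun x => (e1 x).1.differentiableAt, by simp, ?_⟩
    rw [contDiff_one_iff_deriv]
    exact ⟨fun x => (e2 x).1.differentiableAt, hc⟩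
  exact h2.of_le (by norm_num [one_add_one_eq_two])

/-! ### Riemann-Liouville and Riesz derivatives as Fourier multipliers -/

/-- The convolution kernel of the left Riemann-Liouville integral. -/
noncomputable def leftKernel (α t : ℝ) : ℝ := (Set.Ioi (0 : ℝ)).indicator (fun t => t ^ (1 - α)) t

theorem locallyIntegrable_leftKernel {α : ℝ} (hα : α < 2) : LocallyIntegrable (leftKernel α) := by
  refine (locallyIntegrable_iff).2 fun K hK => ?_
  obtain ⟨R, hR⟩ := hK.isBounded.subset_closedBall 0
  rw [Real.closedBall_eq_Icc] at hR
  refine IntegrableOn.mono_set ?_ hR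
  unfold leftKernel
  rw [IntegrableOn, integrable_indicator_iff measurableSet_Ioi, IntegrableOn,
    Measure.restrict_restrict measurableSet_Ioi]
  rcases le_or_gt R 0 with h0 | h0
  · have : Set.Ioi (0 : ℝ) ∩ Set.Icc (0 - R) (0 + R) = ∅ := by
      ext t
      simp only [Set.mem_inter_iff, Set.mem_Ioi, Set.mem_Icc, Set.mem_empty_iff_false, iff_false]
      rintro ⟨h1, -, h2⟩
      linarith
    rw [this]
    simp
  · have := (intervalIntegral.intervalIntegrable_rpow' (a := 0) (b := R) (r := 1 - α)
      (by linarith)).1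
    refine IntegrableOn.mono_set this fun t ht => ⟨ht.1, by simpa using ht.2.2⟩

theorem integral_leftKernel_mul (α : ℝ) (w : ℝ → ℝ) :
    ∫ t, leftKernel α t * w t = ∫ t in Set.Ioi (0 : ℝ), t ^ (1 - α) * w t := by
  rw [← integral_indicator measurableSet_Ioi]
  refine integral_congr_ae (Filter.Eventually.of_forall fun t => ?_)
  simp only [leftKernel, Set.indicator_apply]
  split_ifs <;> simp

/-- On the interval where `u` lives, the left Riemann-Liouville derivative may be computed by
differentiating under the convolution integral. -/
theorem leftRL_eq {α a b x : ℝ} (hα : α < 2) {u v : ℝ → ℝ} (hv : ContDiff ℝ 2 v)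
    (huv : v = (Set.Ioo a b).indicator u) (hx : x ∈ Set.Ioo a b) :
    leftRL α a u x = (Real.Gamma (2 - α))⁻¹ *
      ∫ t in Set.Ioi (0 : ℝ), t ^ (1 - α) * deriv (deriv v) (x - t) := by
  have hk := locallyIntegrable_leftKernel hα
  have hsupp : HasCompactSupport v := by
    refine HasCompactSupport.of_support_subset_isCompact (isCompact_Icc (a := a) (b := b)) ?_
    rw [huv]
    exact (Set.support_indicator_subset).trans Set.Ioo_subset_Icc_self
  have hv1 : ContDiff ℝ 1 (deriv v) := by
    have h : ContDiff ℝ (1 + 1) v := hv.of_le (by norm_num [one_add_one_eq_two])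
    exact (contDiff_succ_iff_deriv.1 h).2.2
  -- The kernel is only locally integrable, so derivatives are moved onto the compactly supported
  -- factor.
  have hd : ∀ {w : ℝ → ℝ}, HasCompactSupport w → ContDiff ℝ 1 w →
      deriv (fun y => ∫ t, leftKernel α t * w (y - t)) =
        fun y => ∫ t, leftKernel α t * deriv w (y - t) := by
    intro w hw hw1
    funext y
    exact (hw.hasDerivAt_convolution_right (ContinuousLinearMap.mul ℝ ℝ) hk hw1 y).deriv
  -- Only the germ at `x` matters. Beyond `b` the two functions may differ, since the left one keeps
  -- integrating `u` without cutting it off.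
  have heq : (fun z => ∫ ξ in a..z, u ξ * (z - ξ) ^ (1 - α)) =ᶠ[nhds x]
      fun z => ∫ t, leftKernel α t * v (z - t) := by
    filter_upwards [Ioo_mem_nhds hx.1 hx.2] with z hz
    have h1 : ∫ t, leftKernel α t * v (z - t) = ∫ ξ, leftKernel α (z - ξ) * v ξ := by
      rw [← integral_sub_left_eq_self _ volume z]
      simp
    rw [h1, intervalIntegral.integral_of_le hz.1.le, ← integral_Ioc_eq_integral_Ioo.symm,
      ← integral_indicator measurableSet_Ioo]
    refine integral_congr_ae (Filter.Eventually.of_forall fun ξ => ?_)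
    simp only [leftKernel, huv, Set.indicator_apply, Set.mem_Ioi, Set.mem_Ioo]
    by_cases h2 : a < ξ <;> by_cases h3 : ξ < z
    · simp [h2, h3, h3.trans hz.2, mul_comm]
    · simp [h3]
    · simp [h2]
    · simp [h2]
  rw [leftRL, heq.iteratedDeriv_eq 2, iteratedDeriv_succ, iteratedDeriv_one,
    hd hsupp (hv.of_le (by norm_num)), hd hsupp.deriv hv1]
  exact congrArg _ (integral_leftKernel_mul α _)

/-- Reflection `ξ ↦ -ξ`; the two signs from the second derivative cancel. -/
theorem rightRL_eq_leftRL (α b : ℝ) (u : ℝ → ℝ) (x : ℝ) :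
    rightRL α b u x = leftRL α (-b) (fun ξ => u (-ξ)) (-x) := by
  let G : ℝ → ℝ := fun y => ∫ ξ in (-b)..y, u (-ξ) * (y - ξ) ^ (1 - α)
  have h : (fun z => ∫ ξ in z..b, u ξ * (ξ - z) ^ (1 - α)) = fun z => G (-z) := by
    funext z
    have := intervalIntegral.integral_comp_neg (a := -b) (b := -z)
      (fun ξ => u ξ * (ξ - z) ^ (1 - α))
    rw [neg_neg, neg_neg] at this
    rw [← this]
    simp only [G, sub_eq_add_neg, add_comm]
  rw [rightRL, h, iteratedDeriv_comp_neg, leftRL]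
  simp [G]

/-- The damping `e^{-εt}` makes the kernel integrable. Fubini then applies, and the inner integral
is the Laplace transform at `ε + 2πiη`. -/
theorem regularized_integral_eq {s ε : ℝ} (hs : 0 < s) (hε : 0 < ε) {G : ℝ → ℂ}
    (hG : Integrable G) (x : ℝ) :
    ∫ t in Set.Ioi (0 : ℝ), ((t ^ (s - 1) : ℝ) : ℂ) * Complex.exp (-(ε * t)) *
        waveIntegral G (x - t) =
      ∫ η : ℝ, Complex.exp (2 * Real.pi * η * x * Complex.I) *
        (G η * ((1 / (ε + 2 * Real.pi * η * Complex.I)) ^ (s : ℂ) * Real.Gamma s)) := by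
  let f : ℝ → ℝ → ℂ := fun t η => ((t ^ (s - 1) : ℝ) : ℂ) * Complex.exp (-(ε * t)) *
    (Complex.exp (2 * Real.pi * η * (x - t : ℝ) * Complex.I) * G η)
  have hA : Integrable (fun t : ℝ => ((t ^ (s - 1) : ℝ) : ℂ) * Complex.exp (-(ε * t)))
      (volume.restrict (Set.Ioi 0)) :=
    integrableOn_rpow_mul_cexp (by linarith) (z := (ε : ℂ)) (by simpa using hε)
  have hf : Integrable (Function.uncurry f) ((volume.restrict (Set.Ioi 0)).prod volume) := by
    have hprod := (hA.mul_prod hG).bdd_mul (c := 1)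
      (f := fun p : ℝ × ℝ => Complex.exp (2 * Real.pi * p.2 * (x - p.1 : ℝ) * Complex.I))
      (Continuous.aestronglyMeasurable (by fun_prop))
      (Filter.Eventually.of_forall fun p => (norm_wave _ _).le)
    refine hprod.congr (Filter.Eventually.of_forall fun p => ?_)
    simp only [Function.uncurry, f]
    ring
  have h1 : ∀ t : ℝ, ((t ^ (s - 1) : ℝ) : ℂ) * Complex.exp (-(ε * t)) * waveIntegral G (x - t) =
      ∫ η, f t η := fun t => by
    rw [waveIntegral, ← integral_const_mul]
  simp_rw [h1]
  rw [integral_integral_swap hf]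
  refine integral_congr_ae (Filter.Eventually.of_forall fun η => ?_)
  simp only
  rw [← laplace_rpow hs (z := ε + 2 * Real.pi * η * Complex.I) (by simpa using hε),
    ← mul_assoc, ← integral_const_mul]
  refine integral_congr_ae (Filter.Eventually.of_forall fun t => ?_)
  have h2 : Complex.exp (2 * Real.pi * η * (x - t : ℝ) * Complex.I) * Complex.exp (-(ε * t)) =
      Complex.exp (2 * Real.pi * η * x * Complex.I) *
        Complex.exp (-((ε + 2 * Real.pi * η * Complex.I) * t)) := by
    rw [← Complex.exp_add, ← Complex.exp_add]
    congr 1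
    push_cast
    ring
  simp only [f]
  linear_combination ((t ^ (s - 1) : ℝ) : ℂ) * G η * h2

/-- The bound does not depend on `ε` and so provides the dominating function for `ε → 0`. -/
theorem norm_one_div_cpow_le {s ε ω : ℝ} (hs : 0 < s) (hω : ω ≠ 0) :
    ‖(1 / (ε + ω * Complex.I)) ^ (s : ℂ)‖ ≤ |ω| ^ (-s) := by
  have h1 : |ω| ≤ ‖(ε + ω * Complex.I : ℂ)‖ := by
    simpa using Complex.abs_im_le_norm (ε + ω * Complex.I : ℂ)
  have h0 : 0 < |ω| := abs_pos.2 hω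
  rw [Complex.norm_cpow_real, norm_div, norm_one, one_div, Real.inv_rpow (norm_nonneg _),
    ← Real.rpow_neg (norm_nonneg _)]
  exact Real.rpow_le_rpow_of_nonpos h0 h1 (by linarith)

/-- The Riemann-Liouville kernel acts on a compactly supported trigonometric integral as a Fourier
multiplier. -/
theorem integral_rpow_mul_eq {α : ℝ} (hα : α < 2) {w : ℝ → ℝ} (hw : Continuous w)
    (hws : HasCompactSupport w) {G : ℝ → ℂ} (hG : Integrable G)
    (hwG : ∀ x, (w x : ℂ) = waveIntegral G x)
    (hGs : Integrable fun η : ℝ => ‖G η‖ * |2 * Real.pi * η| ^ (α - 2)) (x : ℝ) :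
    ((∫ t in Set.Ioi (0 : ℝ), t ^ (1 - α) * w (x - t) : ℝ) : ℂ) =
      ∫ η : ℝ, Complex.exp (2 * Real.pi * η * x * Complex.I) *
        (G η * ((1 / (2 * Real.pi * η * Complex.I)) ^ ((2 - α : ℝ) : ℂ) *
          Real.Gamma (2 - α))) := by
  have hs : 0 < 2 - α := by linarith
  have hs1 : 2 - α - 1 = 1 - α := by ring
  have hreg := fun (ε : ℝ) (hε : 0 < ε) => regularized_integral_eq hs hε hG x
  rw [hs1] at hreg
  have hL : Filter.Tendsto (fun ε : ℝ => ∫ t in Set.Ioi (0 : ℝ),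
      ((t ^ (1 - α) : ℝ) : ℂ) * Complex.exp (-(ε * t)) * waveIntegral G (x - t))
      (nhdsWithin 0 (Set.Ioi 0))
      (nhds (∫ t in Set.Ioi (0 : ℝ), ((t ^ (1 - α) * w (x - t) : ℝ) : ℂ))) := by
    have hbound : IntegrableOn (fun t : ℝ => t ^ (1 - α) * w (x - t)) (Set.Ioi 0) := by
      have h1 := (locallyIntegrable_leftKernel hα).integrable_smul_right_of_hasCompactSupport
        (g := fun t => w (x - t)) (by fun_prop)
        (hws.comp_homeomorph (Homeomorph.subLeft x))
      refine (h1.integrableOn (s := Set.Ioi 0)).congr_fun (fun t ht => ?_) measurableSet_Ioi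
      simp only [leftKernel, Set.indicator_of_mem ht, smul_eq_mul]
    refine tendsto_integral_filter_of_dominated_convergence
      (fun t => ‖t ^ (1 - α) * w (x - t)‖) ?_ ?_ hbound.norm ?_
    · refine Filter.Eventually.of_forall fun ε => Measurable.aestronglyMeasurable ?_
      have := (continuous_waveIntegral hG).measurable
      fun_prop
    · filter_upwards [self_mem_nhdsWithin] with ε hε
      filter_upwards [ae_restrict_mem measurableSet_Ioi] with t ht
      have ht : 0 < t := ht
      have hε : 0 < ε := hε
      rw [← hwG, norm_mul, norm_rpow_mul_cexp ht, norm_mul, Complex.norm_real,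
        Real.norm_of_nonneg (Real.rpow_nonneg ht.le _)]
      gcongr
      refine mul_le_of_le_one_right (Real.rpow_nonneg ht.le _) (Real.exp_le_one_iff.2 ?_)
      rw [Complex.ofReal_re]
      nlinarith
    · refine Filter.Eventually.of_forall fun t => ?_
      rw [← hwG]
      refine tendsto_nhdsWithin_of_tendsto_nhds (Continuous.tendsto' (by fun_prop) _ _ ?_)
      simp
  have hR : Filter.Tendsto (fun ε : ℝ => ∫ η : ℝ,
      Complex.exp (2 * Real.pi * η * x * Complex.I) *
        (G η * ((1 / (ε + 2 * Real.pi * η * Complex.I)) ^ ((2 - α : ℝ) : ℂ) * Real.Gamma (2 - α))))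
      (nhdsWithin 0 (Set.Ioi 0))
      (nhds (∫ η : ℝ, Complex.exp (2 * Real.pi * η * x * Complex.I) *
        (G η * ((1 / (2 * Real.pi * η * Complex.I)) ^ ((2 - α : ℝ) : ℂ) *
          Real.Gamma (2 - α))))) := by
    have hne : ∀ᵐ η : ℝ, η ≠ 0 := by simp [ae_iff]
    refine tendsto_integral_filter_of_dominated_convergence
      (fun η => ‖G η‖ * |2 * Real.pi * η| ^ (α - 2) * ‖(Real.Gamma (2 - α) : ℂ)‖) ?_ ?_
      (hGs.mul_const _) ?_
    · refine Filter.Eventually.of_forall fun ε => AEStronglyMeasurable.mul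
        (Continuous.aestronglyMeasurable (by fun_prop)) (hG.aestronglyMeasurable.mul ?_)
      exact Measurable.aestronglyMeasurable (by fun_prop)
    · refine Filter.Eventually.of_forall fun ε => ?_
      filter_upwards [hne] with η hη
      have hω : 2 * Real.pi * η ≠ 0 := by positivity
      have h1 : ‖(1 / (ε + 2 * Real.pi * η * Complex.I) : ℂ) ^ ((2 - α : ℝ) : ℂ)‖ ≤
          |2 * Real.pi * η| ^ (α - 2) := by
        have e : (ε + 2 * Real.pi * η * Complex.I : ℂ) =
            ε + ((2 * Real.pi * η : ℝ) : ℂ) * Complex.I := by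
          push_cast
          ring
        rw [e]
        exact (norm_one_div_cpow_le hs hω).trans_eq (by rw [neg_sub])
      rw [norm_mul, norm_wave, one_mul, norm_mul, norm_mul, ← mul_assoc]
      exact mul_le_mul_of_nonneg_right (mul_le_mul_of_nonneg_left h1 (norm_nonneg _))
        (norm_nonneg _)
    · filter_upwards [hne] with η hη
      have hω : 2 * Real.pi * η ≠ 0 := by positivity
      refine tendsto_nhdsWithin_of_tendsto_nhds ?_
      refine Filter.Tendsto.const_mul _ (Filter.Tendsto.const_mul _ (Filter.Tendsto.mul_const _ ?_))
      have hz : (2 * Real.pi * η * Complex.I : ℂ) = ((2 * Real.pi * η : ℝ) : ℂ) * Complex.I := by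
        push_cast
        ring
      have hz0 : (2 * Real.pi * η * Complex.I : ℂ) ≠ 0 := by
        rw [hz]
        exact mul_ne_zero (by exact_mod_cast hω) Complex.I_ne_zero
      -- This number is nonzero and purely imaginary, hence off the branch cut of the principal
      -- power.
      have hslit : 1 / (2 * Real.pi * η * Complex.I : ℂ) ∈ Complex.slitPlane := by
        refine Or.inr ?_
        rw [one_div, Complex.inv_im, hz]
        refine div_ne_zero (by simpa using hω) ?_
        rw [← hz]
        exact (Complex.normSq_pos.2 hz0).ne'
      have hcont : ContinuousAt (fun ε : ℝ =>
          (1 / (ε + 2 * Real.pi * η * Complex.I : ℂ)) ^ ((2 - α : ℝ) : ℂ)) 0 := by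
        refine ContinuousAt.cpow ?_ continuousAt_const ?_
        · refine ContinuousAt.div continuousAt_const (by fun_prop) ?_
          simpa using hz0
        · simpa using hslit
      have := hcont.tendsto
      simpa using this
  rw [← integral_complex_ofReal]
  refine tendsto_nhds_unique hL (hR.congr' ?_)
  filter_upwards [self_mem_nhdsWithin] with ε hε
  exact (hreg ε hε).symm

/-- The Fourier multiplier of the left Riemann-Liouville derivative. -/
noncomputable def leftMultiplier (α ω : ℝ) : ℂ :=
  -(ω : ℂ) ^ 2 * (1 / (ω * Complex.I)) ^ ((2 - α : ℝ) : ℂ)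

/-- The powers of `1/(iω)` and `1/(-iω)` are conjugate, with phases `∓(2 - α)π/2`. Their sum brings
in `2 cos((2 - α)π/2) = -2 cos(απ/2)`, and the sign is absorbed by `-ω²`. -/
theorem leftMultiplier_add_of_pos {α ω : ℝ} (hω : 0 < ω) :
    leftMultiplier α ω + leftMultiplier α (-ω) =
      ((2 * Real.cos (α * Real.pi / 2) * ω ^ α : ℝ) : ℂ) := by
  have hI : Complex.I ^ ((2 - α : ℝ) : ℂ) = Complex.exp (((2 - α) * (Real.pi / 2) : ℝ) * Complex.I) := by
    rw [Complex.cpow_def_of_ne_zero Complex.I_ne_zero, Complex.log_I]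
    congr 1
    push_cast
    ring
  have hnI : (-Complex.I) ^ ((2 - α : ℝ) : ℂ) =
      Complex.exp (-(((2 - α) * (Real.pi / 2) : ℝ) * Complex.I)) := by
    rw [Complex.cpow_def_of_ne_zero (neg_ne_zero.2 Complex.I_ne_zero), Complex.log_neg_I]
    congr 1
    push_cast
    ring
  have h1 : (1 / (ω * Complex.I) : ℂ) = ((ω⁻¹ : ℝ) : ℂ) * -Complex.I := by
    rw [one_div, mul_inv, Complex.inv_I, Complex.ofReal_inv]
  have h2 : (1 / (((-ω : ℝ) : ℂ) * Complex.I) : ℂ) = ((ω⁻¹ : ℝ) : ℂ) * Complex.I := by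
    rw [one_div, mul_inv, Complex.inv_I, Complex.ofReal_neg, Complex.ofReal_inv, inv_neg]
    ring
  have hz : ∀ z : ℂ, z ≠ 0 → (((ω⁻¹ : ℝ) : ℂ) * z) ^ ((2 - α : ℝ) : ℂ) =
      ((ω ^ (α - 2) : ℝ) : ℂ) * z ^ ((2 - α : ℝ) : ℂ) := by
    intro z hz0
    have hi : ((ω⁻¹ : ℝ) : ℂ) ≠ 0 := by exact_mod_cast (inv_pos.2 hω).ne'
    rw [Complex.cpow_def_of_ne_zero (mul_ne_zero hi hz0), Complex.log_ofReal_mul (inv_pos.2 hω) hz0,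
      add_mul, Complex.exp_add, Complex.ofReal_log (inv_pos.2 hω).le,
      ← Complex.cpow_def_of_ne_zero hi, ← Complex.cpow_def_of_ne_zero hz0]
    congr 1
    rw [← Complex.ofReal_cpow (inv_nonneg.2 hω.le), Real.inv_rpow hω.le, ← Real.rpow_neg hω.le,
      neg_sub]
  have hpow : ω ^ α = ω ^ 2 * ω ^ (α - 2) := by
    rw [← Real.rpow_natCast, ← Real.rpow_add hω]
    congr 1
    push_cast
    ring
  have hcos : Real.cos (α * Real.pi / 2) = -Real.cos ((2 - α) * (Real.pi / 2)) := by
    rw [← Real.cos_pi_sub]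
    congr 1
    ring
  rw [leftMultiplier, leftMultiplier, h1, h2, hz _ (neg_ne_zero.2 Complex.I_ne_zero),
    hz _ Complex.I_ne_zero, hI, hnI, hcos, hpow]
  have h3 := Complex.two_cos (((2 - α) * (Real.pi / 2) : ℝ) : ℂ)
  rw [neg_mul] at h3
  push_cast at h3 ⊢
  linear_combination ((ω : ℂ) ^ 2 * ((ω ^ (α - 2) : ℝ) : ℂ)) * h3

theorem leftMultiplier_add {α : ℝ} (hα : 0 < α) (ω : ℝ) :
    leftMultiplier α ω + leftMultiplier α (-ω) =
      ((2 * Real.cos (α * Real.pi / 2) * |ω| ^ α : ℝ) : ℂ) := by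
  rcases lt_trichotomy ω 0 with h | rfl | h
  · have := leftMultiplier_add_of_pos (α := α) (neg_pos.2 h)
    rw [neg_neg, add_comm] at this
    rwa [abs_of_neg h]
  · simp [leftMultiplier, Real.zero_rpow hα.ne']
  · rw [abs_of_pos h]
    exact leftMultiplier_add_of_pos h

theorem norm_leftMultiplier {α : ℝ} (hα : 0 < α) (ω : ℝ) : ‖leftMultiplier α ω‖ = |ω| ^ α := by
  rcases eq_or_ne ω 0 with rfl | h
  · simp [leftMultiplier, Real.zero_rpow hα.ne']
  have h0 : 0 < |ω| := abs_pos.2 h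
  rw [leftMultiplier, norm_mul, Complex.norm_cpow_real, norm_neg, norm_pow, Complex.norm_real,
    norm_div, norm_mul, Complex.norm_I, Complex.norm_real, norm_one, mul_one, one_div,
    Real.norm_eq_abs, Real.inv_rpow h0.le, ← Real.rpow_neg h0.le, ← Real.rpow_natCast,
    ← Real.rpow_add h0]
  congr 1
  push_cast
  ring

theorem measurable_leftMultiplier (α : ℝ) : Measurable (leftMultiplier α) := by
  unfold leftMultiplier
  fun_prop

/-- The second derivative contributes `-(2πη)²`, the fractional integral `(2πiη)^(α-2) Γ(2-α)`; the
Gamma factor is cancelled by the normalization. -/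
theorem leftRL_eq_integral {α a b x : ℝ} (hα : α ∈ Set.Ioo (1 : ℝ) 2) {u v : ℝ → ℝ}
    (huv : v = (Set.Ioo a b).indicator u) (hx : x ∈ Set.Ioo a b) {g : ℝ → ℂ}
    (hv : ∀ x, (v x : ℂ) = waveIntegral g x) (hg : Integrable g)
    (hg1 : Integrable fun η : ℝ => (η : ℂ) * g η)
    (hg2 : Integrable fun η : ℝ => (η : ℂ) * (η * g η))
    (hgα : Integrable fun η : ℝ => ‖g η‖ * |2 * Real.pi * η| ^ α) :
    (leftRL α a u x : ℂ) = ∫ η : ℝ, Complex.exp (2 * Real.pi * η * x * Complex.I) *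
      (g η * leftMultiplier α (2 * Real.pi * η)) := by
  obtain ⟨hcd, hdd⟩ := contDiff_two_of_waveIntegral hv hg hg1 hg2
  have hsupp : HasCompactSupport v := by
    refine HasCompactSupport.of_support_subset_isCompact (isCompact_Icc (a := a) (b := b)) ?_
    rw [huv]
    exact (Set.support_indicator_subset).trans Set.Ioo_subset_Icc_self
  have hG : Integrable fun η : ℝ => -(2 * Real.pi * η : ℂ) ^ 2 * g η := by
    refine (hg2.const_mul (-(2 * Real.pi) ^ 2)).congr (Filter.Eventually.of_forall fun η => ?_)
    simp only
    ring
  have hcw : Continuous (deriv (deriv v)) := by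
    have := (continuous_waveIntegral hG)
    have h2 := Complex.continuous_re.comp this
    refine h2.congr fun y => ?_
    rw [Function.comp_apply, ← hdd, Complex.ofReal_re]
  have hGs : Integrable fun η : ℝ =>
      ‖-(2 * Real.pi * η : ℂ) ^ 2 * g η‖ * |2 * Real.pi * η| ^ (α - 2) := by
    refine hgα.congr ?_
    have hne : ∀ᵐ η : ℝ, η ≠ 0 := by simp [ae_iff]
    filter_upwards [hne] with η hη
    have hω : 0 < |2 * Real.pi * η| := by positivity
    have e : (2 * Real.pi * η : ℂ) = ((2 * Real.pi * η : ℝ) : ℂ) := by push_cast; ring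
    have e2 : |2 * Real.pi * η| ^ α = |2 * Real.pi * η| ^ 2 * |2 * Real.pi * η| ^ (α - 2) := by
      rw [← Real.rpow_natCast, ← Real.rpow_add hω]
      congr 1
      push_cast
      ring
    rw [norm_mul, norm_neg, norm_pow, e, Complex.norm_real, Real.norm_eq_abs, e2]
    ring
  have hΓ : (Real.Gamma (2 - α) : ℂ) ≠ 0 := by
    exact_mod_cast (Real.Gamma_pos_of_pos (by linarith [hα.2])).ne'
  rw [leftRL_eq hα.2 hcd huv hx, Complex.ofReal_mul,
    integral_rpow_mul_eq hα.2 hcw hsupp.deriv.deriv hG hdd hGs, ← integral_const_mul]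
  refine integral_congr_ae (Filter.Eventually.of_forall fun η => ?_)
  simp only [leftMultiplier]
  push_cast
  field_simp

/-- The right derivative is the reflected left one, so its multiplier is evaluated at `-2πη`. The
sum of the two multipliers is `2 cos(απ/2) |2πη|^α`, and the Riesz normalization reduces this to
`-|2πη|^α`. -/
theorem riesz_eq_integral {α a b x : ℝ} (hα : α ∈ Set.Ioo (1 : ℝ) 2) {u v : ℝ → ℝ}
    (huv : v = (Set.Ioo a b).indicator u) (hx : x ∈ Set.Ioo a b) {g : ℝ → ℂ}
    (hv : ∀ x, (v x : ℂ) = waveIntegral g x) (hg : Integrable g)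
    (hg1 : Integrable fun η : ℝ => (η : ℂ) * g η)
    (hg2 : Integrable fun η : ℝ => (η : ℂ) * (η * g η))
    (hgα : Integrable fun η : ℝ => ‖g η‖ * |2 * Real.pi * η| ^ α) :
    (riesz α a b u x : ℂ) = -∫ η : ℝ, Complex.exp (2 * Real.pi * η * x * Complex.I) * g η *
      ((|2 * Real.pi * η| ^ α : ℝ) : ℂ) := by
  have hα0 : 0 < α := by linarith [hα.1]
  have hcos : Real.cos (α * Real.pi / 2) ≠ 0 := by
    refine (Real.cos_neg_of_pi_div_two_lt_of_lt ?_ ?_).ne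
    · nlinarith [hα.1, Real.pi_pos]
    · nlinarith [hα.2, Real.pi_pos]
  have hl := leftRL_eq_integral hα huv hx hv hg hg1 hg2 hgα
  have hr := leftRL_eq_integral (x := -x) (a := -b) (b := -a) (u := fun ξ => u (-ξ))
    (v := fun ξ => v (-ξ)) (g := fun η => g (-η)) hα
    (by
      funext ξ
      simp only [huv, Set.indicator_apply, Set.mem_Ioo]
      congr 1
      rw [eq_iff_iff]
      constructor <;> rintro ⟨h1, h2⟩ <;> constructor <;> linarith)
    ⟨neg_lt_neg hx.2, neg_lt_neg hx.1⟩
    (fun y => by rw [waveIntegral_comp_neg, hv]) hg.comp_neg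
    (by simpa using hg1.comp_neg.neg) (by simpa using hg2.comp_neg)
    (by simpa using hgα.comp_neg)
  rw [← rightRL_eq_leftRL, ← integral_neg_eq_self] at hr
  have hint : ∀ {m : ℝ → ℂ}, Measurable m → (∀ η, ‖m η‖ = |2 * Real.pi * η| ^ α) →
      Integrable fun η : ℝ => Complex.exp (2 * Real.pi * η * x * Complex.I) * (g η * m η) := by
    intro m hm hmn
    refine hgα.mono' ?_ (Filter.Eventually.of_forall fun η => ?_)
    · exact (Continuous.aestronglyMeasurable (by fun_prop)).mul
        (hg.aestronglyMeasurable.mul hm.aestronglyMeasurable)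
    · rw [norm_mul, norm_wave, one_mul, norm_mul, hmn]
  have hmeas := measurable_leftMultiplier α
  have hr' : (rightRL α b u x : ℂ) = ∫ η : ℝ, Complex.exp (2 * Real.pi * η * x * Complex.I) *
      (g η * leftMultiplier α (-(2 * Real.pi * η))) := by
    rw [hr]
    refine integral_congr_ae (Filter.Eventually.of_forall fun η => ?_)
    simp
  have hsum : ((leftRL α a u x + rightRL α b u x : ℝ) : ℂ) =
      2 * (Real.cos (α * Real.pi / 2) : ℂ) *
        ∫ η : ℝ, Complex.exp (2 * Real.pi * η * x * Complex.I) * g η *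
          ((|2 * Real.pi * η| ^ α : ℝ) : ℂ) := by
    rw [Complex.ofReal_add, hl, hr', ← integral_add, ← integral_const_mul]
    · refine integral_congr_ae (Filter.Eventually.of_forall fun η => ?_)
      have := leftMultiplier_add hα0 (2 * Real.pi * η)
      simp only
      rw [← mul_add, ← mul_add, this]
      push_cast
      ring
    · exact hint (by fun_prop) fun η => norm_leftMultiplier hα0 _
    · exact hint (by fun_prop) fun η => by rw [norm_leftMultiplier hα0, abs_neg]
  have hcos' : (Real.cos (α * Real.pi / 2) : ℂ) ≠ 0 := by exact_mod_cast hcos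
  generalize (∫ η : ℝ, Complex.exp (2 * Real.pi * η * x * Complex.I) * g η *
    ((|2 * Real.pi * η| ^ α : ℝ) : ℂ)) = Z at hsum ⊢
  rw [riesz, Complex.ofReal_mul, hsum, Complex.ofReal_div, Complex.ofReal_mul]
  simp only [Complex.ofReal_neg, Complex.ofReal_one, Complex.ofReal_ofNat]
  field_simp

/-! ### Functions of finite Fourier weight and consistency in space -/

namespace InFourierBall

variable {r : ℝ} {B : NNReal} {v : ℝ → ℝ}

theorem integrable_ofReal (h : InFourierBall r B v) : Integrable fun x : ℝ => (v x : ℂ) :=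
  h.2.1.ofReal

theorem continuous_fourier (h : InFourierBall r B v) : Continuous (𝓕 fun x : ℝ => (v x : ℂ)) :=
  VectorFourier.fourierIntegral_continuous Real.continuous_fourierChar
    (innerSL ℝ).continuous₂ h.integrable_ofReal

theorem integrable_weight (h : InFourierBall r B v) :
    Integrable fun η : ℝ => (1 + |η|) ^ r * ‖𝓕 (fun x : ℝ => (v x : ℂ)) η‖ := by
  have hc := h.continuous_fourier
  refine ⟨Measurable.aestronglyMeasurable (by fun_prop), ?_⟩
  rw [hasFiniteIntegral_iff_enorm]
  refine lt_of_le_of_lt (le_trans (le_of_eq ?_) h.2.2) ENNReal.coe_lt_top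
  refine lintegral_congr fun η => ?_
  rw [enorm_mul, enorm_norm, Real.enorm_of_nonneg (by positivity)]

theorem integral_weight_le (h : InFourierBall r B v) :
    ∫ η : ℝ, (1 + |η|) ^ r * ‖𝓕 (fun x : ℝ => (v x : ℂ)) η‖ ≤ B := by
  rw [integral_eq_lintegral_of_nonneg_ae (Filter.Eventually.of_forall fun η => by positivity)
    h.integrable_weight.aestronglyMeasurable]
  refine ENNReal.toReal_le_coe_of_le_coe (le_trans (le_of_eq ?_) h.2.2)
  refine lintegral_congr fun η => ?_
  rw [ENNReal.ofReal_mul (by positivity), ofReal_norm]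

/-- Lower moments of the Fourier transform are integrable. -/
theorem integrable_of_le (h : InFourierBall r B v) {m : ℝ → ℂ} (hm : Measurable m) {c : ℝ}
    (hmr : ∀ η, ‖m η‖ ≤ c * (1 + |η|) ^ r) :
    Integrable fun η : ℝ => m η * 𝓕 (fun x : ℝ => (v x : ℂ)) η := by
  refine (h.integrable_weight.const_mul c).mono' ?_ (Filter.Eventually.of_forall fun η => ?_)
  · exact hm.aestronglyMeasurable.mul h.continuous_fourier.aestronglyMeasurable
  · rw [norm_mul, ← mul_assoc]
    gcongr
    exact hmr η

theorem integrable_fourier (h : InFourierBall r B v) (hr : 0 ≤ r) :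
    Integrable (𝓕 fun x : ℝ => (v x : ℂ)) := by
  have := h.integrable_of_le (m := fun _ => 1) (c := 1) measurable_const fun η => by
    rw [norm_one, one_mul]
    exact Real.one_le_rpow (by linarith [abs_nonneg η]) hr
  simpa using this

/-- Fourier inversion holds at every point because `v` is continuous and its transform is
integrable. -/
theorem eq_waveIntegral (h : InFourierBall r B v) (hr : 0 ≤ r) (x : ℝ) :
    (v x : ℂ) = waveIntegral (𝓕 fun x : ℝ => (v x : ℂ)) x := by
  have hc : Continuous fun x : ℝ => (v x : ℂ) := Complex.continuous_ofReal.comp h.1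
  have := congrFun (hc.fourierInv_fourier_eq h.integrable_ofReal (h.integrable_fourier hr)) x
  rw [waveIntegral_eq_fourier, ← this, Real.fourierInv_eq_fourier_neg]

/-- The weight is at least `1`, so the weighted integral dominates the supremum. Applied to `u`,
this confines its values to a range where `∂_v² f` is bounded. -/
theorem abs_le (h : InFourierBall r B v) (hr : 0 ≤ r) (x : ℝ) : |v x| ≤ B := by
  rw [← Real.norm_eq_abs, ← Complex.norm_real, h.eq_waveIntegral hr]
  refine le_trans (norm_integral_le_of_norm_le h.integrable_weight
    (Filter.Eventually.of_forall fun η => ?_)) h.integral_weight_le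
  rw [norm_mul, norm_wave]
  gcongr
  exact Real.one_le_rpow (by linarith [abs_nonneg η]) hr

end InFourierBall

theorem abs_two_pi_mul_rpow_le {p q : ℝ} (hp : 0 ≤ p) (hpq : p ≤ q) (η : ℝ) :
    |2 * Real.pi * η| ^ p ≤ (2 * Real.pi) ^ p * (1 + |η|) ^ q := by
  rw [abs_mul, abs_of_pos Real.two_pi_pos, Real.mul_rpow Real.two_pi_pos.le (abs_nonneg η)]
  gcongr
  calc |η| ^ p ≤ (1 + |η|) ^ p := by
        gcongr
        linarith
    _ ≤ (1 + |η|) ^ q := Real.rpow_le_rpow_of_exponent_le (by linarith [abs_nonneg η]) hpq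

/-- The Toeplitz matrix approximates the Riesz derivative to fourth order. -/
theorem toeplitz_add_riesz_le {α a b : ℝ} (hα : α ∈ Set.Ioo (1 : ℝ) 2) (hab : a < b) {u : ℝ → ℝ}
    {B : NNReal} (hu : InFourierBall (4 + α) B ((Set.Ioo a b).indicator u)) {N : ℕ} {h : ℝ}
    (hh : h = (b - a) / (N + 1)) (i : Fin N) :
    |(toeplitz α N *ᵥ fun j : Fin N => u (a + ((j : ℝ) + 1) * h)) i / h ^ α +
      riesz α a b u (a + ((i : ℝ) + 1) * h)| ≤ (2 * Real.pi) ^ (4 + α) * B * h ^ 4 := by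
  obtain ⟨hα1, hα2⟩ := id hα
  have hN : (0 : ℝ) < N + 1 := by positivity
  have hh0 : 0 < h := by
    rw [hh]
    exact div_pos (sub_pos.2 hab) hN
  have hb : a + (N + 1) * h = b := by
    rw [hh]
    field_simp
    ring
  have hgrid : ∀ j : Fin N, a + ((j : ℝ) + 1) * h ∈ Set.Ioo a b := by
    intro j
    have hj : (j : ℝ) + 1 < N + 1 := by
      have : (j : ℝ) < N := by exact_mod_cast j.2
      linarith
    constructor
    · have : 0 < ((j : ℝ) + 1) * h := by positivity
      linarith
    · rw [← hb]
      gcongr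
  set v := (Set.Ioo a b).indicator u with hvdef
  set g := 𝓕 fun x : ℝ => (v x : ℂ) with hgdef
  have hr : 0 ≤ 4 + α := by linarith
  have hg : Integrable g := hu.integrable_fourier hr
  have hv := hu.eq_waveIntegral hr
  have hge1 : ∀ η : ℝ, 1 ≤ 1 + |η| := fun η => by linarith [abs_nonneg η]
  have hg1 : Integrable fun η : ℝ => (η : ℂ) * g η := by
    refine hu.integrable_of_le (c := 1) (by fun_prop) fun η => ?_
    rw [Complex.norm_real, Real.norm_eq_abs, one_mul]
    calc |η| ≤ (1 + |η|) ^ (1 : ℝ) := by rw [Real.rpow_one]; linarith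
      _ ≤ _ := Real.rpow_le_rpow_of_exponent_le (hge1 η) (by linarith)
  have hg2 : Integrable fun η : ℝ => (η : ℂ) * (η * g η) := by
    simp_rw [← mul_assoc]
    refine hu.integrable_of_le (c := 1) (by fun_prop) fun η => ?_
    rw [norm_mul, Complex.norm_real, Real.norm_eq_abs, one_mul]
    calc |η| * |η| ≤ (1 + |η|) ^ (2 : ℝ) := by
          rw [Real.rpow_two]
          nlinarith [abs_nonneg η]
      _ ≤ _ := Real.rpow_le_rpow_of_exponent_le (hge1 η) (by linarith)
  have hgα : Integrable fun η : ℝ => ((|2 * Real.pi * η| ^ α : ℝ) : ℂ) * g η := by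
    refine hu.integrable_of_le (c := (2 * Real.pi) ^ α) (by fun_prop) fun η => ?_
    rw [Complex.norm_real, Real.norm_of_nonneg (by positivity)]
    exact abs_two_pi_mul_rpow_le (by linarith) (by linarith) η
  have hgα' : Integrable fun η : ℝ => ‖g η‖ * |2 * Real.pi * η| ^ α := by
    refine hgα.norm.congr (Filter.Eventually.of_forall fun η => ?_)
    simp only
    rw [norm_mul, Complex.norm_real, Real.norm_of_nonneg (by positivity), mul_comm]
  have hsamples : (fun j : Fin N => u (a + ((j : ℝ) + 1) * h)) =
      fun j : Fin N => v (a + ((j : ℝ) + 1) * h) := by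
    funext j
    rw [hvdef, Set.indicator_of_mem (hgrid j)]
  have hT := toeplitz_mulVec_eq (α := α) (by linarith) hg hv hh0
    (fun y hy => by
      rw [hb] at hy
      rw [hvdef, Set.indicator_of_notMem hy]) i
  have hR := riesz_eq_integral hα hvdef (hgrid i) hv hg hg1 hg2 hgα'
  -- The Riesz multiplier is negative, so the sum in the statement becomes the integral of a
  -- difference of symbols.
  rw [hsamples, ← Real.norm_eq_abs, ← Complex.norm_real, Complex.ofReal_add, Complex.ofReal_div, hT,
    hR, ← sub_eq_add_neg, ← integral_div, ← integral_sub]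
  · have hbound : (2 * Real.pi) ^ (4 + α) * B * h ^ 4 ≥
        ∫ η : ℝ, (2 * Real.pi) ^ (4 + α) * h ^ 4 * ((1 + |η|) ^ (4 + α) * ‖g η‖) := by
      rw [integral_const_mul, mul_right_comm]
      gcongr
      exact hu.integral_weight_le
    refine le_trans (norm_integral_le_of_norm_le (hu.integrable_weight.const_mul _)
      (Filter.Eventually.of_forall fun η => ?_)) hbound
    have hs := abs_scaled_symbol_sub_le hα1.le hα2.le hh0 (2 * Real.pi * η)
    have hw := abs_two_pi_mul_rpow_le hr le_rfl η
    have e : ∀ z w : ℂ, z * w * (symbol α (h * (2 * Real.pi * η)) : ℂ) / ((h ^ α : ℝ) : ℂ) -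
        z * w * ((|2 * Real.pi * η| ^ α : ℝ) : ℂ) =
        z * (w * ((symbol α (h * (2 * Real.pi * η)) / h ^ α - |2 * Real.pi * η| ^ α : ℝ) : ℂ)) := by
      intro z w
      push_cast
      ring
    rw [e, norm_mul, norm_wave, one_mul, norm_mul, Complex.norm_real, Real.norm_eq_abs]
    calc ‖g η‖ * |symbol α (h * (2 * Real.pi * η)) / h ^ α - |2 * Real.pi * η| ^ α|
        ≤ ‖g η‖ * (h ^ 4 * ((2 * Real.pi) ^ (4 + α) * (1 + |η|) ^ (4 + α))) := by
          gcongr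
          exact hs.trans (by gcongr)
      _ = _ := by ring
  · refine Integrable.div_const ?_ _
    refine (integrable_wave hg _).mul_bdd (c := 8) ?_ (Filter.Eventually.of_forall fun η => ?_)
    · have := continuous_symbol (α := α) (by linarith)
      exact Continuous.aestronglyMeasurable (by fun_prop)
    · rw [Complex.norm_real, Real.norm_of_nonneg (symbol_nonneg (by linarith) _)]
      exact symbol_le_eight hα1.le hα2.le _
  · refine hgα.norm.mono' ?_ (Filter.Eventually.of_forall fun η => ?_)
    · exact (integrable_wave hg _).aestronglyMeasurable.mul
        (Measurable.aestronglyMeasurable (by fun_prop))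
    · rw [norm_mul, norm_mul, norm_wave, one_mul, norm_mul, mul_comm]

/-! ### Taylor estimates in time -/

/-- The mean value inequality on the segment from `c` to `t`. Iterating it gives Taylor bounds with
one-sided derivatives at end points, at the price of the factorials. -/
theorem abs_le_pow_of_hasDerivWithinAt {s : Set ℝ} (hs : Convex ℝ s) {g g' : ℝ → ℝ} {c C : ℝ}
    {n : ℕ} (hC : 0 ≤ C) (hc : c ∈ s) (h0 : g c = 0)
    (hg : ∀ t ∈ s, HasDerivWithinAt g (g' t) s t) (hb : ∀ t ∈ s, |g' t| ≤ C * |t - c| ^ n) :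
    ∀ t ∈ s, |g t| ≤ C * |t - c| ^ (n + 1) := by
  intro t ht
  have hsub : Set.uIcc c t ⊆ s := by
    rw [← segment_eq_uIcc]
    exact hs.segment_subset hc ht
  have h := (convex_uIcc c t).norm_image_sub_le_of_norm_hasDerivWithin_le (f := g) (f' := g')
    (C := C * |t - c| ^ n) (fun x hx => (hg x (hsub hx)).mono hsub) (fun x hx => ?_)
    Set.left_mem_uIcc Set.right_mem_uIcc
  · rw [h0, sub_zero, Real.norm_eq_abs, Real.norm_eq_abs] at h
    rw [pow_succ, ← mul_assoc]
    exact h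
  · refine (hb x (hsub hx)).trans ?_
    gcongr ?_ * ?_ ^ n
    exact Set.abs_sub_left_of_mem_uIcc hx

section Taylor

variable {s : Set ℝ} {f f₁ f₂ f₃ : ℝ → ℝ} {c B : ℝ}

theorem taylor_first (hs : Convex ℝ s) (hB : 0 ≤ B) (hc : c ∈ s)
    (h1 : ∀ t ∈ s, HasDerivWithinAt f (f₁ t) s t) (hb : ∀ t ∈ s, |f₁ t| ≤ B) :
    ∀ t ∈ s, |f t - f c| ≤ B * |t - c| := by
  simpa using abs_le_pow_of_hasDerivWithinAt (g := fun t => f t - f c) (g' := f₁) (n := 0) hs hB hc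
    (by simp) (fun t ht => (h1 t ht).sub_const _) (by simpa using hb)

theorem taylor_second (hs : Convex ℝ s) (hB : 0 ≤ B) (hc : c ∈ s)
    (h1 : ∀ t ∈ s, HasDerivWithinAt f (f₁ t) s t) (h2 : ∀ t ∈ s, HasDerivWithinAt f₁ (f₂ t) s t)
    (hb : ∀ t ∈ s, |f₂ t| ≤ B) :
    ∀ t ∈ s, |f t - f c - f₁ c * (t - c)| ≤ B * |t - c| ^ 2 := by
  refine abs_le_pow_of_hasDerivWithinAt (g := fun t => f t - f c - f₁ c * (t - c))
    (g' := fun t => f₁ t - f₁ c) (n := 1) hs hB hc (by simp) (fun t ht => ?_)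
    (by simpa using taylor_first hs hB hc h2 hb)
  have h3 := ((hasDerivWithinAt_id t s).sub_const c).const_mul (f₁ c)
  rw [mul_one] at h3
  exact ((h1 t ht).sub_const (f c)).sub h3

theorem taylor_third (hs : Convex ℝ s) (hB : 0 ≤ B) (hc : c ∈ s)
    (h1 : ∀ t ∈ s, HasDerivWithinAt f (f₁ t) s t) (h2 : ∀ t ∈ s, HasDerivWithinAt f₁ (f₂ t) s t)
    (h3 : ∀ t ∈ s, HasDerivWithinAt f₂ (f₃ t) s t) (hb : ∀ t ∈ s, |f₃ t| ≤ B) :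
    ∀ t ∈ s, |f t - f c - f₁ c * (t - c) - f₂ c / 2 * (t - c) ^ 2| ≤ B * |t - c| ^ 3 := by
  refine abs_le_pow_of_hasDerivWithinAt
    (g := fun t => f t - f c - f₁ c * (t - c) - f₂ c / 2 * (t - c) ^ 2)
    (g' := fun t => f₁ t - f₁ c - f₂ c * (t - c)) (n := 2) hs hB hc (by simp) (fun t ht => ?_)
    (taylor_second hs hB hc h2 h3 hb)
  have h4 := ((hasDerivWithinAt_id t s).sub_const c).const_mul (f₁ c)
  have h5 := (((hasDerivWithinAt_id t s).sub_const c).pow 2).const_mul (f₂ c / 2)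
  refine ((((h1 t ht).sub_const (f c)).sub h4).sub h5).congr_deriv ?_
  simp
  ring

/-- The midpoint rule for difference quotients. -/
theorem abs_sub_sub_mul_midpoint_le (hs : Convex ℝ s) (hB : 0 ≤ B) {δ : ℝ} (hδ : 0 ≤ δ) (hc : c ∈ s)
    (hl : c - δ / 2 ∈ s) (hr : c + δ / 2 ∈ s)
    (h1 : ∀ t ∈ s, HasDerivWithinAt f (f₁ t) s t) (h2 : ∀ t ∈ s, HasDerivWithinAt f₁ (f₂ t) s t)
    (h3 : ∀ t ∈ s, HasDerivWithinAt f₂ (f₃ t) s t) (hb : ∀ t ∈ s, |f₃ t| ≤ B) :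
    |f (c + δ / 2) - f (c - δ / 2) - δ * f₁ c| ≤ B * δ ^ 3 / 4 := by
  -- The quadratic terms cancel in the difference, leaving two remainders `B (δ/2)³`.
  have e1 := taylor_third hs hB hc h1 h2 h3 hb _ hl
  have e2 := taylor_third hs hB hc h1 h2 h3 hb _ hr
  rw [sub_sub_cancel_left, abs_neg, abs_of_nonneg (a := δ / 2) (by positivity), abs_le] at e1
  rw [add_sub_cancel_left, abs_of_nonneg (a := δ / 2) (by positivity), abs_le] at e2
  rw [abs_le]
  constructor <;> linarith [e1.1, e1.2, e2.1, e2.2]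

/-- The trapezoidal average. -/
theorem abs_average_sub_le (hs : Convex ℝ s) (hB : 0 ≤ B) {δ : ℝ} (hδ : 0 ≤ δ) (hc : c ∈ s)
    (hl : c - δ / 2 ∈ s) (hr : c + δ / 2 ∈ s)
    (h1 : ∀ t ∈ s, HasDerivWithinAt f (f₁ t) s t) (h2 : ∀ t ∈ s, HasDerivWithinAt f₁ (f₂ t) s t)
    (hb : ∀ t ∈ s, |f₂ t| ≤ B) :
    |(f (c + δ / 2) + f (c - δ / 2)) / 2 - f c| ≤ B * δ ^ 2 / 4 := by
  have e1 := taylor_second hs hB hc h1 h2 hb _ hl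
  have e2 := taylor_second hs hB hc h1 h2 hb _ hr
  rw [sub_sub_cancel_left, abs_neg, abs_of_nonneg (a := δ / 2) (by positivity), abs_le] at e1
  rw [add_sub_cancel_left, abs_of_nonneg (a := δ / 2) (by positivity), abs_le] at e2
  rw [abs_le]
  constructor <;> linarith [e1.1, e1.2, e2.1, e2.2]

/-- Linear extrapolation to the midpoint from the two preceding grid points. -/
theorem abs_extrapolation_sub_le (hs : Convex ℝ s) (hB : 0 ≤ B) {δ : ℝ} (hδ : 0 ≤ δ) (hc : c ∈ s)
    (hl : c - δ / 2 ∈ s) (hll : c - 3 * δ / 2 ∈ s)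
    (h1 : ∀ t ∈ s, HasDerivWithinAt f (f₁ t) s t) (h2 : ∀ t ∈ s, HasDerivWithinAt f₁ (f₂ t) s t)
    (hb : ∀ t ∈ s, |f₂ t| ≤ B) :
    |3 / 2 * f (c - δ / 2) - 1 / 2 * f (c - 3 * δ / 2) - f c| ≤ 3 / 2 * B * δ ^ 2 := by
  -- The weights `3/2` and `-1/2` cancel the linear terms; the remainders are `3/2 · 1/4 + 1/2 · 9/4
  -- = 3/2` times `B δ²`.
  have e1 := taylor_second hs hB hc h1 h2 hb _ hl
  have e2 := taylor_second hs hB hc h1 h2 hb _ hll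
  rw [sub_sub_cancel_left, abs_neg, abs_of_nonneg (a := δ / 2) (by positivity), abs_le] at e1
  rw [sub_sub_cancel_left, abs_neg, abs_of_nonneg (a := 3 * δ / 2) (by positivity), abs_le] at e2
  rw [abs_le]
  constructor <;> linarith [e1.1, e1.2, e2.1, e2.2]

end Taylor

theorem hasDerivWithinAt_iteratedDerivWithin {s : Set ℝ} (hs : UniqueDiffOn ℝ s) {f : ℝ → ℝ} {n k : ℕ}
    (hf : ContDiffOn ℝ n f s) (hk : k < n) {t : ℝ} (ht : t ∈ s) :
    HasDerivWithinAt (iteratedDerivWithin k f s) (iteratedDerivWithin (k + 1) f s t) s t := by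
  rw [iteratedDerivWithin_succ]
  exact (hf.differentiableOn_iteratedDerivWithin (by exact_mod_cast hk) hs t ht).hasDerivWithinAt

/-- Extrapolating a `C²` function of the data against evaluating it at extrapolated data. -/
theorem abs_extrapolate_comp_le {g : ℝ → ℝ} (hg : ContDiff ℝ 2 g) {R K p q : ℝ} (hR : 0 ≤ R)
    (hK : ∀ v, |v| ≤ 2 * R → |iteratedDeriv 2 g v| ≤ K) (hp : |p| ≤ R) (hq : |q| ≤ R) :
    |3 / 2 * g p - 1 / 2 * g q - g (3 / 2 * p - 1 / 2 * q)| ≤ K * |p - q| ^ 2 := by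
  have hK0 : 0 ≤ K := (abs_nonneg _).trans (hK 0 (by simpa using hR))
  have hg2 : ContDiff ℝ (1 + 1) g := hg.of_le (by norm_num [one_add_one_eq_two])
  obtain ⟨hd, -, hg1⟩ := contDiff_succ_iff_deriv.1 hg2
  have hd1 := (contDiff_one_iff_deriv.1 hg1).1
  rw [abs_le] at hp hq
  have hpI : p ∈ Set.Icc (-(2 * R)) (2 * R) := ⟨by linarith, by linarith⟩
  -- Expansion at `p`: the other points are `q` and `p + (p - q)/2`, and the linear terms cancel.
  -- The extrapolated value is bounded by `3R/2 + R/2`, hence the range `2R`.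
  have ht := taylor_second (f := g) (f₁ := deriv g) (f₂ := deriv (deriv g)) (c := p)
    (convex_Icc (-(2 * R)) (2 * R)) hK0 hpI
    (fun t _ => (hd t).hasDerivAt.hasDerivWithinAt) (fun t _ => (hd1 t).hasDerivAt.hasDerivWithinAt)
    (fun t ht => by
      have := hK t (abs_le.2 ht)
      rwa [iteratedDeriv_succ, iteratedDeriv_one] at this)
  have e1 := ht q ⟨by linarith, by linarith⟩
  have e2 := ht (3 / 2 * p - 1 / 2 * q) ⟨by linarith, by linarith⟩
  have hpq : 0 ≤ K * |p - q| ^ 2 := by positivity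
  rw [abs_sub_comm q p, abs_le] at e1
  have e3 : 3 / 2 * p - 1 / 2 * q - p = (p - q) / 2 := by ring
  rw [e3, abs_div, div_pow, abs_of_pos (two_pos (α := ℝ)), abs_le] at e2
  rw [abs_le]
  constructor <;> linarith [e1.1, e1.2, e2.1, e2.2]

/-! ### Truncation errors on the grid -/

namespace Problem

variable (P : Problem)

/-- The Kronecker factors act along grid lines, which reduces consistency in the plane to the
one-dimensional estimate in each direction. -/
theorem J_mulVec_apply (M Nx Ny : ℕ) (V : Fin Ny × Fin Nx → ℝ) (j : Fin Ny) (i : Fin Nx) :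
    (P.J M Nx Ny *ᵥ V) (j, i) = P.dt M / 2 *
      (P.Kα * ((toeplitz P.α Nx *ᵥ fun i' => V (j, i')) i / P.hX Nx ^ P.α) +
        P.Kβ * ((toeplitz P.β Ny *ᵥ fun j' => V (j', i)) j / P.hY Ny ^ P.β)) := by
  have h1 : (((1 : Matrix (Fin Ny) (Fin Ny) ℝ) ⊗ₖ toeplitz P.α Nx) *ᵥ V) (j, i) =
      (toeplitz P.α Nx *ᵥ fun i' => V (j, i')) i := by
    simp [Matrix.mulVec, dotProduct, Fintype.sum_prod_type, Matrix.one_apply, ite_mul]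
  have h2 : ((toeplitz P.β Ny ⊗ₖ (1 : Matrix (Fin Nx) (Fin Nx) ℝ)) *ᵥ V) (j, i) =
      (toeplitz P.β Ny *ᵥ fun j' => V (j', i)) j := by
    simp [Matrix.mulVec, dotProduct, Fintype.sum_prod_type, Matrix.one_apply, ite_mul, mul_ite]
  rw [J, Matrix.add_mulVec, Matrix.smul_mulVec, Matrix.smul_mulVec, Pi.add_apply, Pi.smul_apply,
    Pi.smul_apply, h1, h2, smul_eq_mul, smul_eq_mul]
  have := (Real.rpow_pos_of_pos (P.hX_pos Nx) P.α).ne'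
  have := (Real.rpow_pos_of_pos (P.hY_pos Ny) P.β).ne'
  field_simp

theorem gridX_mem (Nx : ℕ) (i : Fin Nx) : P.gridX Nx i ∈ Set.Ioo P.xL P.xR := by
  have hi : (i : ℝ) < Nx := by exact_mod_cast i.2
  have hN : (0 : ℝ) < Nx + 1 := by positivity
  have h := P.hX_pos Nx
  have hb : P.xL + (Nx + 1) * P.hX Nx = P.xR := by
    rw [hX]
    field_simp
    ring
  rw [gridX]
  constructor
  · have : 0 < ((i : ℝ) + 1) * P.hX Nx := by positivity
    linarith
  · nlinarith

theorem gridY_mem (Ny : ℕ) (j : Fin Ny) : P.gridY Ny j ∈ Set.Ioo P.yD P.yU := by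
  have hj : (j : ℝ) < Ny := by exact_mod_cast j.2
  have hN : (0 : ℝ) < Ny + 1 := by positivity
  have h := P.hY_pos Ny
  have hb : P.yD + (Ny + 1) * P.hY Ny = P.yU := by
    rw [hY]
    field_simp
    ring
  rw [gridY]
  constructor
  · have : 0 < ((j : ℝ) + 1) * P.hY Ny := by positivity
    linarith
  · nlinarith

theorem grid_mem (Nx Ny : ℕ) (i : Fin Nx) (j : Fin Ny) :
    (P.gridX Nx i, P.gridY Ny j) ∈ P.Ω :=
  ⟨P.gridX_mem Nx i, P.gridY_mem Ny j⟩

theorem mul_dt_mem {M : ℕ} (hM : 0 < M) {r : ℝ} (h0 : 0 ≤ r) (h1 : r ≤ M) :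
    r * P.dt M ∈ Set.Icc 0 P.T := by
  have hM' : (0 : ℝ) < M := by exact_mod_cast hM
  refine ⟨mul_nonneg h0 (P.dt_pos hM).le, ?_⟩
  rw [dt, mul_div_assoc', div_le_iff₀ hM', mul_comm]
  exact mul_le_mul_of_nonneg_left h1 P.hT.le

variable {P} {u : ℝ → ℝ → ℝ → ℝ} {B : NNReal} {L : ℝ}

theorem IsSmooth.abs_apply_le (h : P.IsSmooth u B) {x y t : ℝ} (hxy : (x, y) ∈ P.Ω)
    (ht : t ∈ Set.Icc 0 P.T) : |u x y t| ≤ B := by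
  have := (h.space_x y hxy.2 t ht).abs_le (by linarith [P.hα.1]) x
  rwa [Set.indicator_of_mem hxy.1] at this

/-- The diffusion term is discretized to fourth order. -/
theorem IsSmooth.J_mulVec_sample (h : P.IsSmooth u B) {M : ℕ} (hM : 0 < M) {Nx Ny m : ℕ}
    (hm : m ≤ M) (p : Fin Ny × Fin Nx) :
    |(P.J M Nx Ny *ᵥ P.sample M Nx Ny u m) p + P.dt M / 2 *
        P.diffusion u (P.gridX Nx p.2) (P.gridY Ny p.1) (m * P.dt M)| ≤
      P.dt M / 2 * ((P.Kα * (2 * Real.pi) ^ (4 + P.α) + P.Kβ * (2 * Real.pi) ^ (4 + P.β)) * B *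
        (P.hX Nx ^ 4 + P.hY Ny ^ 4)) := by
  obtain ⟨j, i⟩ := p
  have ht : (m : ℝ) * P.dt M ∈ Set.Icc 0 P.T :=
    P.mul_dt_mem hM (by positivity) (by exact_mod_cast hm)
  have h1 := toeplitz_add_riesz_le P.hα P.hx (h.space_x _ (P.gridY_mem Ny j) _ ht)
    (h := P.hX Nx) rfl i
  have h2 := toeplitz_add_riesz_le P.hβ P.hy (h.space_y _ (P.gridX_mem Nx i) _ ht)
    (h := P.hY Ny) rfl j
  have hdt := P.dt_pos hM
  have hKα := P.hKα
  have hKβ := P.hKβ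
  rw [J_mulVec_apply, diffusion, ← mul_add, abs_mul, abs_of_pos (half_pos hdt)]
  refine mul_le_mul_of_nonneg_left ?_ (half_pos hdt).le
  have e : ∀ a b c d : ℝ, P.Kα * a + P.Kβ * b + (P.Kα * c + P.Kβ * d) =
      P.Kα * (a + c) + P.Kβ * (b + d) := fun a b c d => by ring
  rw [e]
  refine (abs_add_le _ _).trans ?_
  rw [abs_mul, abs_mul, abs_of_pos hKα, abs_of_pos hKβ]
  refine (add_le_add (mul_le_mul_of_nonneg_left h1 hKα.le)
    (mul_le_mul_of_nonneg_left h2 hKβ.le)).trans ?_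
  have hx := P.hX_pos Nx
  have hy := P.hY_pos Ny
  have n1 : 0 ≤ P.Kα * (2 * Real.pi) ^ (4 + P.α) * B * P.hY Ny ^ 4 := by positivity
  have n2 : 0 ≤ P.Kβ * (2 * Real.pi) ^ (4 + P.β) * B * P.hX Nx ^ 4 := by positivity
  linarith

end Problem

namespace Problem

variable {P : Problem} {u : ℝ → ℝ → ℝ → ℝ} {B : NNReal} {L : ℝ}

/-- The trapezoidal rule for the differential equation, evaluated at the midpoint of a time step. -/
theorem IsSmooth.time_truncation (h : P.IsSmooth u B) (hu : P.IsExactSolution u) {x y : ℝ}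
    (hxy : (x, y) ∈ P.Ω) {c δ : ℝ} (hδ : 0 < δ) (hl : 0 ≤ c - δ / 2) (hr : c + δ / 2 ≤ P.T) :
    |u x y (c + δ / 2) - u x y (c - δ / 2) -
      δ * ((P.diffusion u x y (c + δ / 2) + P.diffusion u x y (c - δ / 2)) / 2 +
        P.f x y c (u x y c))| ≤ δ * (B * δ ^ 2) := by
  have hs : UniqueDiffOn ℝ (Set.Icc 0 P.T) := uniqueDiffOn_Icc P.hT
  have hc : c ∈ Set.Ioc 0 P.T := ⟨by linarith, by linarith⟩
  have hcI : c ∈ Set.Icc 0 P.T := ⟨hc.1.le, hc.2⟩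
  have hlI : c - δ / 2 ∈ Set.Icc 0 P.T := ⟨hl, by linarith⟩
  have hrI : c + δ / 2 ∈ Set.Icc 0 P.T := ⟨by linarith, hr⟩
  have hD : ∀ k < 3, ∀ t ∈ Set.Icc 0 P.T, HasDerivWithinAt
      (iteratedDerivWithin k (fun s => u x y s) (Set.Icc 0 P.T))
      (iteratedDerivWithin (k + 1) (fun s => u x y s) (Set.Icc 0 P.T) t) (Set.Icc 0 P.T) t :=
    fun k hk t ht => hasDerivWithinAt_iteratedDerivWithin hs (n := 3) (h.time x y hxy) hk ht
  have hE : ∀ k < 2, ∀ t ∈ Set.Icc 0 P.T, HasDerivWithinAt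
      (iteratedDerivWithin k (fun s => P.diffusion u x y s) (Set.Icc 0 P.T))
      (iteratedDerivWithin (k + 1) (fun s => P.diffusion u x y s) (Set.Icc 0 P.T) t)
      (Set.Icc 0 P.T) t :=
    fun k hk t ht =>
      hasDerivWithinAt_iteratedDerivWithin hs (n := 2) (h.diffusion_time x y hxy) hk ht
  have h1 := abs_sub_sub_mul_midpoint_le (convex_Icc 0 P.T) B.coe_nonneg hδ.le hcI hlI hrI
    (hD 0 (by norm_num)) (hD 1 (by norm_num)) (hD 2 (by norm_num))
    (h.time_bound x y hxy 3 (by simp))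
  have h2 := abs_average_sub_le (convex_Icc 0 P.T) B.coe_nonneg hδ.le hcI hlI hrI
    (hE 0 (by norm_num)) (hE 1 (by norm_num)) (h.diffusion_bound x y hxy)
  -- The differential equation is needed only at the midpoint `c`.
  have heq : iteratedDerivWithin 1 (fun s => u x y s) (Set.Icc 0 P.T) c =
      P.diffusion u x y c + P.f x y c (u x y c) := by
    rw [iteratedDerivWithin_one]
    exact (hu.equation x y hxy c hc).derivWithin (hs c hcI)
  rw [zero_add, heq] at h1
  simp only [iteratedDerivWithin_zero] at h1 h2
  have hB : (0 : ℝ) ≤ B := B.coe_nonneg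
  have h3 := mul_le_mul_of_nonneg_left h2 hδ.le
  rw [← abs_of_pos hδ, ← abs_mul, abs_of_pos hδ, abs_le] at h3
  rw [abs_le] at h1 ⊢
  have h4 : 0 ≤ δ * (B * δ ^ 2) := by positivity
  constructor <;> nlinarith [h1.1, h1.2, h3.1, h3.2]

/-- Extrapolation of the source term to the midpoint of a time step. -/
theorem IsSmooth.source_extrapolation (h : P.IsSmooth u B) (hf : P.LipschitzSource L)
    (hf2 : P.SmoothSource) (hL : 0 ≤ L) {K : ℝ}
    (hK : ∀ x y, (x, y) ∈ P.Ω → ∀ t ∈ Set.Ioc 0 P.T, ∀ v : ℝ, |v| ≤ 2 * B →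
      |iteratedDeriv 2 (P.f x y t) v| ≤ K) {x y : ℝ}
    (hxy : (x, y) ∈ P.Ω) {c δ : ℝ} (hδ : 0 < δ) (hl : 0 ≤ c - 3 * δ / 2) (hr : c ≤ P.T) :
    |3 / 2 * P.f x y c (u x y (c - δ / 2)) - 1 / 2 * P.f x y c (u x y (c - 3 * δ / 2)) -
      P.f x y c (u x y c)| ≤ (K * B ^ 2 + 3 / 2 * L * B) * δ ^ 2 := by
  have hs : UniqueDiffOn ℝ (Set.Icc 0 P.T) := uniqueDiffOn_Icc P.hT
  have hc : c ∈ Set.Ioc 0 P.T := ⟨by linarith, by linarith⟩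
  have hcI : c ∈ Set.Icc 0 P.T := ⟨hc.1.le, hc.2⟩
  have hlI : c - δ / 2 ∈ Set.Icc 0 P.T := ⟨by linarith, by linarith⟩
  have hllI : c - 3 * δ / 2 ∈ Set.Icc 0 P.T := ⟨hl, by linarith⟩
  have hD : ∀ k < 3, ∀ t ∈ Set.Icc 0 P.T, HasDerivWithinAt
      (iteratedDerivWithin k (fun s => u x y s) (Set.Icc 0 P.T))
      (iteratedDerivWithin (k + 1) (fun s => u x y s) (Set.Icc 0 P.T) t) (Set.Icc 0 P.T) t :=
    fun k hk t ht => hasDerivWithinAt_iteratedDerivWithin hs (n := 3) (h.time x y hxy) hk ht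
  have h1 := abs_extrapolation_sub_le (convex_Icc 0 P.T) B.coe_nonneg hδ.le hcI hlI hllI
    (hD 0 (by norm_num)) (hD 1 (by norm_num)) (h.time_bound x y hxy 2 (by simp))
  have h2 := taylor_first (convex_Icc 0 P.T) B.coe_nonneg hllI (hD 0 (by norm_num))
    (h.time_bound x y hxy 1 (by simp)) _ hlI
  simp only [iteratedDerivWithin_zero] at h1 h2
  have e : c - δ / 2 - (c - 3 * δ / 2) = δ := by ring
  rw [e, abs_of_pos hδ] at h2
  -- The time argument of `f` is frozen at `c`, so no smoothness of `f` in `t` is needed. `f` of the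
  -- extrapolated `u` serves as intermediate value: `h3` compares it with the extrapolated `f`, `h5`
  -- with `f` at the midpoint value.
  have h3 := abs_extrapolate_comp_le (hf2.1 x y hxy c hc) B.coe_nonneg (hK x y hxy c hc)
    (h.abs_apply_le hxy hlI) (h.abs_apply_le hxy hllI)
  have hK0 : 0 ≤ K := (abs_nonneg _).trans (hK x y hxy c hc 0 (by simp))
  have h4 : K * |u x y (c - δ / 2) - u x y (c - 3 * δ / 2)| ^ 2 ≤ K * (B * δ) ^ 2 := by
    gcongr
  have h5 := (hf.2 x y hxy c hc _ _).trans (mul_le_mul_of_nonneg_left h1 hL)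
  have h6 := (abs_sub_le _ _ _).trans (add_le_add (h3.trans h4) h5)
  refine h6.trans_eq ?_
  ring

/-- On the first step, the source term is taken at the initial value. -/
theorem IsSmooth.source_initial (h : P.IsSmooth u B) (hf : P.LipschitzSource L) (hL : 0 ≤ L)
    {x y : ℝ} (hxy : (x, y) ∈ P.Ω) {c : ℝ} (hc : c ∈ Set.Ioc 0 P.T) :
    |P.f x y c (u x y 0) - P.f x y c (u x y c)| ≤ L * (B * c) := by
  have hs : UniqueDiffOn ℝ (Set.Icc 0 P.T) := uniqueDiffOn_Icc P.hT
  have hcI : c ∈ Set.Icc 0 P.T := ⟨hc.1.le, hc.2⟩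
  have h0 : (0 : ℝ) ∈ Set.Icc 0 P.T := ⟨le_rfl, P.hT.le⟩
  have h2 := taylor_first (convex_Icc 0 P.T) B.coe_nonneg hcI
    (fun t ht => hasDerivWithinAt_iteratedDerivWithin hs (n := 3) (k := 0) (h.time x y hxy)
      (by norm_num) ht)
    (h.time_bound x y hxy 1 (by simp)) _ h0
  simp only [iteratedDerivWithin_zero] at h2
  rw [zero_sub, abs_neg, abs_of_pos hc.1] at h2
  exact (hf.2 x y hxy c hc _ _).trans (mul_le_mul_of_nonneg_left h2 hL)

variable (P) in
/-- The residual of the sampled exact solution in the scheme. -/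
noncomputable def residual (M Nx Ny : ℕ) (u : ℝ → ℝ → ℝ → ℝ) (m : ℕ) : Fin Ny × Fin Nx → ℝ :=
  (1 + P.J M Nx Ny) *ᵥ P.sample M Nx Ny u (m + 1) - (1 - P.J M Nx Ny) *ᵥ P.sample M Nx Ny u m -
    P.dt M • ((3 / 2 : ℝ) • P.source M Nx Ny m (P.sample M Nx Ny u m) -
      (1 / 2 : ℝ) • P.source M Nx Ny m (P.sample M Nx Ny u (m - 1)))

/-- For `m = 0` truncated subtraction gives `m - 1 = 0`, and the combination collapses to `f` at the
initial value. That is only first-order accurate, whence the extra term. -/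
theorem IsSmooth.abs_source_le (h : P.IsSmooth u B) (hf : P.LipschitzSource L)
    (hf2 : P.SmoothSource) (hL : 0 ≤ L) {K : ℝ} (hK0 : 0 ≤ K)
    (hK : ∀ x y, (x, y) ∈ P.Ω → ∀ t ∈ Set.Ioc 0 P.T, ∀ v : ℝ, |v| ≤ 2 * B →
      |iteratedDeriv 2 (P.f x y t) v| ≤ K) {x y : ℝ} (hxy : (x, y) ∈ P.Ω) {M m : ℕ} (hm : m < M) :
    |3 / 2 * P.f x y ((m + 1 / 2) * P.dt M) (u x y (m * P.dt M)) -
      1 / 2 * P.f x y ((m + 1 / 2) * P.dt M) (u x y ((m - 1 : ℕ) * P.dt M)) -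
      P.f x y ((m + 1 / 2) * P.dt M) (u x y ((m + 1 / 2) * P.dt M))| ≤
      (K * B ^ 2 + 3 / 2 * L * B) * P.dt M ^ 2 + if m = 0 then L * B * P.dt M else 0 := by
  have hM : 0 < M := by omega
  have hdt := P.dt_pos hM
  have hmM : (m : ℝ) + 1 ≤ M := by exact_mod_cast hm
  have hc : ((m : ℝ) + 1 / 2) * P.dt M ∈ Set.Icc 0 P.T :=
    P.mul_dt_mem hM (by positivity) (by linarith)
  have hc0 : 0 < ((m : ℝ) + 1 / 2) * P.dt M := by positivity
  have hB : (0 : ℝ) ≤ B := B.coe_nonneg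
  rcases Nat.eq_zero_or_pos m with rfl | hpos
  · have h1 := h.source_initial hf hL hxy (c := (1 / 2) * P.dt M)
      ⟨by positivity, by simpa using hc.2⟩
    simp only [Nat.cast_zero, zero_mul, zero_add, Nat.zero_sub, if_true]
    have e : ∀ a b : ℝ, 3 / 2 * a - 1 / 2 * a - b = a - b := fun a b => by ring
    rw [e]
    refine h1.trans ?_
    have n1 : 0 ≤ (K * B ^ 2 + 3 / 2 * L * B) * P.dt M ^ 2 := by positivity
    have n2 : 0 ≤ L * B * P.dt M := by positivity
    linarith
  · obtain ⟨k, rfl⟩ : ∃ k, m = k + 1 := ⟨m - 1, by omega⟩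
    have h1 := h.source_extrapolation hf hf2 hL hK hxy (δ := P.dt M)
      (c := (((k + 1 : ℕ) : ℝ) + 1 / 2) * P.dt M) hdt
      (by push_cast; nlinarith [mul_nonneg (Nat.cast_nonneg (α := ℝ) k) hdt.le]) hc.2
    have e1 : (((k + 1 : ℕ) : ℝ) + 1 / 2) * P.dt M - P.dt M / 2 = ((k + 1 : ℕ) : ℝ) * P.dt M := by
      ring
    have e2 : (((k + 1 : ℕ) : ℝ) + 1 / 2) * P.dt M - 3 * P.dt M / 2 = (k : ℝ) * P.dt M := by
      push_cast
      ring
    rw [e1, e2] at h1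
    simpa using h1

/-- The residual splits into the time truncation at the midpoint, the spatial errors at the two time
levels, and the source extrapolation. `C₁` collects the temporal constants, `C₂` the spatial ones.
-/
theorem IsSmooth.abs_residual_le (h : P.IsSmooth u B) (hu : P.IsExactSolution u)
    (hf : P.LipschitzSource L) (hf2 : P.SmoothSource) (hL : 0 ≤ L) :
    ∃ C : ℝ, 0 ≤ C ∧ ∀ M Nx Ny m : ℕ, m < M → ∀ p, |P.residual M Nx Ny u m p| ≤
      P.dt M * (C * (P.dt M ^ 2 + P.hX Nx ^ 4 + P.hY Ny ^ 4)) +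
        if m = 0 then L * B * P.dt M ^ 2 else 0 := by
  obtain ⟨K', hK'⟩ := hf2.2 (2 * B)
  obtain ⟨K, hK0, hK⟩ : ∃ K : ℝ, 0 ≤ K ∧ ∀ x y, (x, y) ∈ P.Ω → ∀ t ∈ Set.Ioc 0 P.T, ∀ v : ℝ,
      |v| ≤ 2 * B → |iteratedDeriv 2 (P.f x y t) v| ≤ K :=
    ⟨|K'|, abs_nonneg _, fun x y hxy t ht v hv => (hK' x y hxy t ht v hv).trans (le_abs_self _)⟩
  have hB : (0 : ℝ) ≤ B := B.coe_nonneg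
  have hKα := P.hKα
  have hKβ := P.hKβ
  set C₁ : ℝ := B + (K * B ^ 2 + 3 / 2 * L * B) with hC₁
  set C₂ : ℝ := (P.Kα * (2 * Real.pi) ^ (4 + P.α) + P.Kβ * (2 * Real.pi) ^ (4 + P.β)) * B with hC₂
  have hC₁0 : 0 ≤ C₁ := by positivity
  have hC₂0 : 0 ≤ C₂ := by positivity
  refine ⟨C₁ + C₂, by positivity, fun M Nx Ny m hm p => ?_⟩
  have hM : 0 < M := by omega
  have hdt := P.dt_pos hM
  have hxy := P.grid_mem Nx Ny p.2 p.1
  have hmM : (m : ℝ) + 1 ≤ M := by exact_mod_cast hm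
  have hJ1 := h.J_mulVec_sample hM (Nx := Nx) (Ny := Ny) hm p
  have hJ0 := h.J_mulVec_sample hM (Nx := Nx) (Ny := Ny) hm.le p
  have hS := mul_le_mul_of_nonneg_left (h.abs_source_le hf hf2 hL hK0 hK hxy hm) hdt.le
  have hT := h.time_truncation hu hxy (c := ((m : ℝ) + 1 / 2) * P.dt M) (δ := P.dt M) hdt
    (by nlinarith [mul_nonneg (Nat.cast_nonneg (α := ℝ) m) hdt.le])
    (by
      have := (P.mul_dt_mem hM (r := (m : ℝ) + 1) (by positivity) hmM).2
      linarith)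
  have e1 : ((m : ℝ) + 1 / 2) * P.dt M + P.dt M / 2 = ((m + 1 : ℕ) : ℝ) * P.dt M := by
    push_cast
    ring
  have e2 : ((m : ℝ) + 1 / 2) * P.dt M - P.dt M / 2 = (m : ℝ) * P.dt M := by ring
  rw [e1, e2] at hT
  rw [← hC₂] at hJ0 hJ1
  rw [← abs_of_pos hdt, ← abs_mul, abs_of_pos hdt] at hS
  have hR : P.residual M Nx Ny u m p =
      u (P.gridX Nx p.2) (P.gridY Ny p.1) ((m + 1 : ℕ) * P.dt M) +
        (P.J M Nx Ny *ᵥ P.sample M Nx Ny u (m + 1)) p -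
      (u (P.gridX Nx p.2) (P.gridY Ny p.1) (m * P.dt M) -
        (P.J M Nx Ny *ᵥ P.sample M Nx Ny u m) p) -
      P.dt M * (3 / 2 * P.f (P.gridX Nx p.2) (P.gridY Ny p.1) ((m + 1 / 2) * P.dt M)
          (u (P.gridX Nx p.2) (P.gridY Ny p.1) (m * P.dt M)) -
        1 / 2 * P.f (P.gridX Nx p.2) (P.gridY Ny p.1) ((m + 1 / 2) * P.dt M)
          (u (P.gridX Nx p.2) (P.gridY Ny p.1) ((m - 1 : ℕ) * P.dt M))) := by
    rw [residual, Matrix.add_mulVec, Matrix.sub_mulVec, Matrix.one_mulVec, Matrix.one_mulVec]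
    rfl
  have hif : P.dt M * ((K * B ^ 2 + 3 / 2 * L * B) * P.dt M ^ 2 +
      if m = 0 then L * B * P.dt M else 0) =
      P.dt M * ((K * B ^ 2 + 3 / 2 * L * B) * P.dt M ^ 2) +
      if m = 0 then L * B * P.dt M ^ 2 else 0 := by
    split_ifs <;> ring
  rw [hif] at hS
  rw [hR]
  generalize (if m = 0 then L * B * P.dt M ^ 2 else 0) = E at hS ⊢
  have n1 : 0 ≤ P.dt M * (C₁ * (P.hX Nx ^ 4 + P.hY Ny ^ 4)) := by positivity
  have n2 : 0 ≤ P.dt M * (C₂ * P.dt M ^ 2) := by positivity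
  have hexp : P.dt M * ((C₁ + C₂) * (P.dt M ^ 2 + P.hX Nx ^ 4 + P.hY Ny ^ 4)) =
      P.dt M * (B * P.dt M ^ 2) + P.dt M * ((K * B ^ 2 + 3 / 2 * L * B) * P.dt M ^ 2) +
        P.dt M * (C₁ * (P.hX Nx ^ 4 + P.hY Ny ^ 4)) +
        P.dt M * (C₂ * P.dt M ^ 2) + P.dt M * (C₂ * (P.hX Nx ^ 4 + P.hY Ny ^ 4)) := by
    rw [hC₁]
    ring
  rw [hexp]
  rw [abs_le] at hT hJ0 hJ1 hS ⊢
  constructor <;> linarith [hT.1, hT.2, hJ0.1, hJ0.2, hJ1.1, hJ1.2, hS.1, hS.2]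

/-! ### Error recursion and conclusion -/

theorem LipschitzSource.discNorm_source_sub_le (hf : P.LipschitzSource L) (hL : 0 ≤ L)
    {M Nx Ny m : ℕ} (hm : m < M) {c : ℝ} (V W : Fin Ny × Fin Nx → ℝ) :
    P.discNorm Nx Ny (c • (P.source M Nx Ny m V - P.source M Nx Ny m W)) ≤
      |c| * (L * P.discNorm Nx Ny (V - W)) := by
  rw [← P.discNorm_smul _ _ hL, ← P.discNorm_smul _ _ (abs_nonneg c)]
  refine P.discNorm_mono fun p => ?_
  have hM : 0 < M := by omega
  have hdt := P.dt_pos hM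
  have hmM : (m : ℝ) + 1 ≤ M := by exact_mod_cast hm
  have hc : ((m : ℝ) + 1 / 2) * P.dt M ∈ Set.Ioc 0 P.T :=
    ⟨by positivity, (P.mul_dt_mem hM (by positivity) (by linarith)).2⟩
  simp only [Pi.smul_apply, Pi.sub_apply, smul_eq_mul, abs_mul, abs_abs, source, abs_of_nonneg hL]
  gcongr
  exact hf.2 _ _ (P.grid_mem Nx Ny p.2 p.1) _ hc _ _

/-- Propagation of the error over one time step. -/
theorem IsSchemeSolution.error_step (hf : P.LipschitzSource L) (hL : 0 ≤ L) {M Nx Ny m : ℕ}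
    {U : ℕ → Fin Ny × Fin Nx → ℝ} (hU : P.IsSchemeSolution M Nx Ny U) (hm : m < M) :
    P.discNorm Nx Ny (P.sample M Nx Ny u (m + 1) - U (m + 1)) ≤
      P.discNorm Nx Ny (P.sample M Nx Ny u m - U m) + P.dt M * L *
        (3 / 2 * P.discNorm Nx Ny (P.sample M Nx Ny u m - U m) +
          1 / 2 * P.discNorm Nx Ny (P.sample M Nx Ny u (m - 1) - U (m - 1))) +
      P.discNorm Nx Ny (P.residual M Nx Ny u m) := by
  have hdt := P.dt_pos (show 0 < M by omega)
  set F := P.source M Nx Ny m with hF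
  have hstep : (1 + P.J M Nx Ny) *ᵥ (P.sample M Nx Ny u (m + 1) - U (m + 1)) =
      (1 - P.J M Nx Ny) *ᵥ (P.sample M Nx Ny u m - U m) +
        ((P.dt M * (3 / 2)) • (F (P.sample M Nx Ny u m) - F (U m)) +
          (-(P.dt M * (1 / 2))) • (F (P.sample M Nx Ny u (m - 1)) - F (U (m - 1))) +
          P.residual M Nx Ny u m) := by
    rw [Matrix.mulVec_sub, Matrix.mulVec_sub, hU.step m hm, residual]
    module
  have h1 := P.discNorm_step hstep
  have h2 := P.discNorm_add_le Nx Ny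
    ((P.dt M * (3 / 2)) • (F (P.sample M Nx Ny u m) - F (U m)) +
      (-(P.dt M * (1 / 2))) • (F (P.sample M Nx Ny u (m - 1)) - F (U (m - 1))))
    (P.residual M Nx Ny u m)
  have h3 := P.discNorm_add_le Nx Ny
    ((P.dt M * (3 / 2)) • (F (P.sample M Nx Ny u m) - F (U m)))
    ((-(P.dt M * (1 / 2))) • (F (P.sample M Nx Ny u (m - 1)) - F (U (m - 1))))
  have h4 := hf.discNorm_source_sub_le hL hm (c := P.dt M * (3 / 2)) (P.sample M Nx Ny u m) (U m)
  have h5 := hf.discNorm_source_sub_le hL hm (c := -(P.dt M * (1 / 2)))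
    (P.sample M Nx Ny u (m - 1)) (U (m - 1))
  rw [abs_of_pos (by positivity)] at h4
  rw [abs_neg, abs_of_pos (by positivity)] at h5
  linarith

end Problem

end RieszRD

theorem theorem3p2 (L : ℝ) (hL : 0 < L) :
    ∃ C_R : ℝ, 0 < C_R ∧
      ∀ (P : RieszRD.Problem) (u : ℝ → ℝ → ℝ → ℝ) (B : NNReal),
        P.LipschitzSource L → P.SmoothSource → P.IsExactSolution u → P.IsSmooth u B →
        ∃ Cstar : ℝ, 0 < Cstar ∧
          ∀ M Nx Ny : ℕ, 0 < M → 0 < Nx → 0 < Ny →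
            ∀ U : ℕ → Fin Ny × Fin Nx → ℝ, P.IsSchemeSolution M Nx Ny U →
              ∀ m < M,
                P.discNorm Nx Ny (P.sample M Nx Ny u (m + 1) - U (m + 1)) ≤
                  P.T * Cstar * Real.exp (3 * P.T * C_R) *
                    (P.dt M ^ 2 + P.hX Nx ^ 4 + P.hY Ny ^ 4) := by
  -- Gronwall yields `exp(2TL)`, so `C_R = L` is more than enough.
  refine ⟨L, hL, fun P u B hf hf2 hu h => ?_⟩
  obtain ⟨C, hC, hres⟩ := h.abs_residual_le hu hf hf2 hL.le
  have hT := P.hT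
  have hB : (0 : ℝ) ≤ B := B.coe_nonneg
  obtain ⟨S, hS0, hS⟩ : ∃ S : ℝ, 0 ≤ S ∧ S = √((P.xR - P.xL) * (P.yU - P.yD)) :=
    ⟨_, Real.sqrt_nonneg _, rfl⟩
  -- The first-step perturbation is not summed over time and so carries no factor `T`; dividing by
  -- `T` compensates for the one in the claim. The `1` ensures positivity.
  refine ⟨S * (L * B) / P.T + S * C + 1, by positivity, ?_⟩
  intro M Nx Ny hM _ _ U hU m hm
  have hdt := P.dt_pos hM
  set Q := P.dt M ^ 2 + P.hX Nx ^ 4 + P.hY Ny ^ 4 with hQ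
  have hx := P.hX_pos Nx
  have hy := P.hY_pos Ny
  have hQ0 : 0 ≤ Q := by positivity
  have hdQ : P.dt M ^ 2 ≤ Q := by
    rw [hQ, add_assoc]
    exact le_add_of_nonneg_right (by positivity)
  have h0 : P.discNorm Nx Ny (P.sample M Nx Ny u 0 - U 0) = 0 := by
    have : P.sample M Nx Ny u 0 - U 0 = 0 := by
      funext p
      rw [Pi.sub_apply, hU.initial, RieszRD.Problem.sample, Nat.cast_zero, zero_mul,
        hu.initial _ _ (P.grid_mem Nx Ny p.2 p.1), sub_self, Pi.zero_apply]
    rw [this]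
    simp [RieszRD.Problem.discNorm]
  have hgron := RieszRD.discrete_gronwall (M := M) (δ := P.dt M) (L := L)
    (a := fun k => P.discNorm Nx Ny (P.sample M Nx Ny u k - U k))
    (ρ := S * (P.dt M * (C * Q))) (E := S * (L * B * P.dt M ^ 2))
    (by positivity) (by positivity) (by positivity) h0 (fun k hk => by
      have h1 := hU.error_step (u := u) hf hL.le hk
      have h2 : P.discNorm Nx Ny (P.residual M Nx Ny u k) ≤
          S * (P.dt M * (C * Q) + if k = 0 then L * B * P.dt M ^ 2 else 0) := by
        rw [hS]
        refine P.discNorm_le_of_abs_le ?_ (hres M Nx Ny k hk)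
        split_ifs <;> positivity
      have h3 : S * (P.dt M * (C * Q) + if k = 0 then L * B * P.dt M ^ 2 else 0) =
          S * (P.dt M * (C * Q)) + if k = 0 then S * (L * B * P.dt M ^ 2) else 0 := by
        split_ifs <;> ring
      rw [h3] at h2
      linarith) (m + 1) hm
  refine hgron.trans ?_
  have hmT : ((m + 1 : ℕ) : ℝ) * P.dt M ≤ P.T :=
    (P.mul_dt_mem hM (by positivity) (by exact_mod_cast hm)).2
  have hexp : (1 + 2 * (P.dt M * L)) ^ (m + 1) ≤ Real.exp (3 * P.T * L) := by
    calc (1 + 2 * (P.dt M * L)) ^ (m + 1) ≤ Real.exp (2 * (P.dt M * L)) ^ (m + 1) := by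
          gcongr
          rw [add_comm]
          exact Real.add_one_le_exp _
      _ = Real.exp (((m + 1 : ℕ) : ℝ) * (2 * (P.dt M * L))) := (Real.exp_nat_mul _ _).symm
      _ ≤ Real.exp (3 * P.T * L) := by
          refine Real.exp_le_exp.2 ?_
          nlinarith [mul_le_mul_of_nonneg_right hmT hL.le, mul_pos hT hL]
  have hsum : S * (L * B * P.dt M ^ 2) + ((m + 1 : ℕ) : ℝ) * (S * (P.dt M * (C * Q))) ≤
      P.T * (S * (L * B) / P.T + S * C + 1) * Q := by
    have i1 : S * (L * B * P.dt M ^ 2) ≤ S * (L * B) * Q := by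
      rw [← mul_assoc]
      exact mul_le_mul_of_nonneg_left hdQ (by positivity)
    have i2 : ((m + 1 : ℕ) : ℝ) * (S * (P.dt M * (C * Q))) ≤ P.T * (S * C * Q) := by
      have := mul_le_mul_of_nonneg_right hmT (show 0 ≤ S * C * Q by positivity)
      linarith
    have i3 : P.T * (S * (L * B) / P.T + S * C + 1) * Q =
        S * (L * B) * Q + P.T * (S * C * Q) + P.T * Q := by
      field_simp
    rw [i3]
    have := mul_nonneg hT.le hQ0
    linarith
  calc _ ≤ P.T * (S * (L * B) / P.T + S * C + 1) * Q * Real.exp (3 * P.T * L) :=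
        mul_le_mul hsum hexp (by positivity) (by positivity)
    _ = _ := by ring
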